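/- Let $f\in C^2(\mathbb{R}^{d_1}\times\mathbb{R}^{d_2},\mathbb{R})$ and consider the zero-sum game with leader's cost $f_1=f$ and follower's cost $f_2=-f$. Write $D_i$ for derivatives in the $i$-th variable and $D_{21}f_2=D_1(D_2f_2)$. Suppose that 1. (Follower) for every $x_1$, the dynamics $\dot x_2=-D_2f_2(x_1,x_2)$ have a globally asymptotically stable equilibrium $r(x_1)$, and $r:\mathbb{R}^{d_1}\to\mathbb{R}^{d_2}$ is Lipschitz. (Globally asymptotically stable means: Lyapunov stable, and every solution on $[0,\infty)$ converges to the equilibrium.) 2. (Total derivative) $Df_1$ denotes either of the maps (i) $Df_1(x)=D_1f_1(x)-D_2f_1(x)\,(D_2^2f_2(x))^{-1}D_{21}f_2(x)$, where $D_2^2f_2(x)$ is assumed invertible for all $x$; or (ii) $Df_1(x)=D_1f_1(x)+D_2f_1(x)\,Dr(x_1)$ with $Dr(x_1)=-(D_2^2f_2(x_1,r(x_1)))^{-1}D_{21}f_2(x_1,r(x_1))$, where $D_2^2f_2(x_1,r(x_1))$ is assumed invertible for all $x_1$. The maps $Df_1$ and $D_2f_2$ are Lipschitz on $\mathbb{R}^{d_1+d_2}$,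 and $Df_1$ is bounded. 3. (Reduced dynamics) $\dot x_1=-Df_1(x_1,r(x_1))$ has a globally asymptotically stable equilibrium $x_1^\ast$, and it is non-degenerate, i.e. the Jacobian of $x_1\mapsto Df_1(x_1,r(x_1))$ at $x_1^\ast$ is invertible. 4. (Learning rates) $\gamma_{i,k}>0$, $\sum_k\gamma_{i,k}=\infty$, $\sum_k\gamma_{i,k}^2<\infty$ for $i=1,2$, and $\gamma_{1,k}=o(\gamma_{2,k})$. 5. (Updates and noise) On a probability space, random sequences satisfy, for all $k\ge 0$, $$x_{1,k+1}=x_{1,k}-\gamma_{1,k}\bigl(Df_1(x_k)+w_{1,k+1}\bigr),\qquad x_{2,k+1}=x_{2,k}-\gamma_{2,k}\bigl(D_2f_2(x_k)+w_{2,k+1}\bigr),$$ where, with $\mathcal{F}_k=\sigma(x_s,w_{1,s},w_{2,s}:s\le k)$, the noises $w_{i,k+1}$ are square integrable, $\mathbb{E}[w_{i,k+1}\mid\mathcal{F}_k]=0$ a.s., and $\mathbb{E}[\|w_{i,k+1}\|^2\mid\mathcal{F}_k]\le c_i(1+\|x_k\|^2)$ a.s. for constants $c_i$. Then $x^\ast=(x_1^\ast,r(x_1^\ast))$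 is a differential Stackelberg equilibrium of $(f,-f)$ with player 1 as the leader, and, for almost every sample path on the event $\{\sup_k(\|x_{1,k}\|^2+\|x_{2,k}\|^2)<\infty\}$, $(x_{1,k},x_{2,k})\to x^\ast$ as $k\to\infty$. Here $(x_1^\ast,x_2^\ast)$ is a differential Stackelberg equilibrium of $(f_1,f_2)$ if $D_2f_2(x_1^\ast,x_2^\ast)=0$, the follower's Hessian $D_2^2f_2(x_1^\ast,x_2^\ast)$ is positive definite, and, for the $C^1$ map $r$ defined near $x_1^\ast$ by $D_2f_2(x_1,r(x_1))=0$ and $r(x_1^\ast)=x_2^\ast$, one has $Df_1(x_1^\ast,r(x_1^\ast))=0$ and the total second derivative $D^2f_1(x_1^\ast,r(x_1^\ast))$, i.e. the derivative of $x_1\mapsto Df_1(x_1,r(x_1))$ at $x_1^\ast$, is positive definite. -/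

import Mathlib

open Filter Topology MeasureTheory
open scoped NNReal

noncomputable section

namespace StackelbergGame

section Derivatives

variable {E₁ E₂ : Type*}
  [NormedAddCommGroup E₁] [InnerProductSpace ℝ E₁] [CompleteSpace E₁]
  [NormedAddCommGroup E₂] [InnerProductSpace ℝ E₂] [CompleteSpace E₂]

/-- `D₁ g`, the gradient of `g` in the leader's variable, as a vector. -/
def grad₁ (g : E₁ × E₂ → ℝ) (x : E₁ × E₂) : E₁ :=
  gradient (fun y => g (y, x.2)) x.1

/-- `D₂ g`, the gradient of `g` in the follower's variable, as a vector. -/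
def grad₂ (g : E₁ × E₂ → ℝ) (x : E₁ × E₂) : E₂ :=
  gradient (fun z => g (x.1, z)) x.2

/-- `D₂² g`, the Hessian of `g` in the follower's variable. -/
def hess₂ (g : E₁ × E₂ → ℝ) (x : E₁ × E₂) : E₂ →L[ℝ] E₂ :=
  fderiv ℝ (fun z => grad₂ g (x.1, z)) x.2

/-- `D₂₁ g`, the derivative of `D₂ g` in the leader's variable. -/
def mixed₂₁ (g : E₁ × E₂ → ℝ) (x : E₁ × E₂) : E₁ →L[ℝ] E₂ :=
  fderiv ℝ (fun y => grad₂ g (y, x.2)) x.1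

/-- The derivative `Dr = -(D₂² f₂)⁻¹ ∘ D₂₁ f₂` of the follower's implicit reaction,
evaluated at a joint action `x` (meaningful where `D₂² f₂ x` is invertible). -/
def reactionDeriv (f₂ : E₁ × E₂ → ℝ) (x : E₁ × E₂) : E₁ →L[ℝ] E₂ :=
  -((hess₂ f₂ x).inverse ∘L mixed₂₁ f₂ x)

/-- `D₁ f₁(x) + D₂ f₁(x) ∘ S`, as a vector: the leader's gradient at `x` when it believes that
the follower's reaction has slope `S`. -/
def gradAlong (f₁ : E₁ × E₂ → ℝ) (S : E₁ →L[ℝ] E₂) (x : E₁ × E₂) : E₁ :=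
  grad₁ f₁ x + ContinuousLinearMap.adjoint S (grad₂ f₁ x)

/-- The total derivative
`Df₁(x) = D₁ f₁(x) - D₂ f₁(x) ∘ (D₂² f₂(x))⁻¹ ∘ D₂₁ f₂(x)`, as a vector. -/
def totalGrad (f₁ f₂ : E₁ × E₂ → ℝ) (x : E₁ × E₂) : E₁ :=
  gradAlong f₁ (reactionDeriv f₂ x) x

/-- `G` is the leader's total derivative `Df₁`, where `r` is the follower's reaction map.
Away from the graph of `r` two expressions are in use: the slope of the reaction is evaluated
either at the current joint action `x` (then `D₂² f₂` has to be invertible everywhere), or at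
the point `(x₁, r x₁)` of the graph, i.e. `Df₁(x) = D₁ f₁(x) + D₂ f₁(x) ∘ Dr(x₁)` (then `D₂² f₂`
has to be invertible along the graph). They agree on the graph; both are admitted. -/
def IsLeaderField (f₁ f₂ : E₁ × E₂ → ℝ) (r : E₁ → E₂) (G : E₁ × E₂ → E₁) : Prop :=
  ((∀ x, (hess₂ f₂ x).IsInvertible) ∧ ∀ x, G x = totalGrad f₁ f₂ x) ∨
  ((∀ y, (hess₂ f₂ (y, r y)).IsInvertible) ∧
    ∀ x, G x = gradAlong f₁ (reactionDeriv f₂ (x.1, r x.1)) x)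

end Derivatives

/-- A positive definite (symmetric) operator. -/
def IsPosDef {E : Type*} [NormedAddCommGroup E] [InnerProductSpace ℝ E] (A : E →L[ℝ] E) : Prop :=
  (A : E →ₗ[ℝ] E).IsSymmetric ∧ ∀ v : E, v ≠ 0 → 0 < inner ℝ (A v) v

/-- `x = (x₁, x₂)` is a differential Stackelberg equilibrium of the game `(f₁, f₂)` with player 1
as the leader: with `r` the reaction map implicitly defined near `x₁` by `D₂ f₂ (y, r y) = 0` and
`r x₁ = x₂`, the follower's Hessian `D₂² f₂ x` is positive definite, `Df₁(x₁, r x₁) = 0`, and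
the total second derivative `D² f₁(x₁, r x₁)` of `f₁` along `r` is positive definite. -/
def IsDifferentialStackelberg {E₁ E₂ : Type*}
    [NormedAddCommGroup E₁] [InnerProductSpace ℝ E₁] [CompleteSpace E₁]
    [NormedAddCommGroup E₂] [InnerProductSpace ℝ E₂] [CompleteSpace E₂]
    (f₁ f₂ : E₁ × E₂ → ℝ) (x : E₁ × E₂) : Prop :=
  IsPosDef (hess₂ f₂ x) ∧
  ∃ r : E₁ → E₂, ContDiffAt ℝ 1 r x.1 ∧ r x.1 = x.2 ∧
    (∀ᶠ y in 𝓝 x.1, grad₂ f₂ (y, r y) = 0) ∧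
    totalGrad f₁ f₂ x = 0 ∧
    ∃ H : E₁ →L[ℝ] E₁,
      HasFDerivAt (fun y => totalGrad f₁ f₂ (y, r y)) H x.1 ∧ IsPosDef H

section Dynamics

variable {E : Type*} [NormedAddCommGroup E] [NormedSpace ℝ E]

/-- `y` solves `ẏ = F(y)` on `[0, ∞)`. -/
def IsForwardSolution (F : E → E) (y : ℝ → E) : Prop :=
  ∀ t ∈ Set.Ici (0 : ℝ), HasDerivWithinAt y (F (y t)) (Set.Ici 0) t

/-- `p` is a globally asymptotically stable equilibrium of `ẏ = F(y)`: it is an equilibrium, it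
is Lyapunov stable, and every solution converges to it. -/
def IsGloballyAsymptoticallyStable (F : E → E) (p : E) : Prop :=
  F p = 0 ∧
  (∀ ε > 0, ∃ δ > 0, ∀ y : ℝ → E, IsForwardSolution F y → ‖y 0 - p‖ < δ →
    ∀ t ≥ 0, ‖y t - p‖ < ε) ∧
  ∀ y : ℝ → E, IsForwardSolution F y → Tendsto y atTop (𝓝 p)

end Dynamics

section Stochastic

variable {Ω : Type*}

/-- The `σ`-algebra `𝓕ₖ = σ(x₁ₛ, x₂ₛ, w₁ₛ, w₂ₛ : s ≤ k)` generated by the history of the iterates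
and of the noise up to step `k`. -/
@[reducible] def history {E₁ E₂ : Type*} [MeasurableSpace E₁] [MeasurableSpace E₂]
    (x₁ w₁ : ℕ → Ω → E₁) (x₂ w₂ : ℕ → Ω → E₂) (k : ℕ) : MeasurableSpace Ω :=
  ⨆ s ∈ Set.Iic k,
    MeasurableSpace.comap (fun ω => ((x₁ s ω, x₂ s ω), (w₁ s ω, w₂ s ω))) inferInstance

/-- Learning rates: positive, `∑ γₖ = ∞` and `∑ γₖ² < ∞`. -/
def IsLearningRate (γ : ℕ → ℝ) : Prop :=
  (∀ k, 0 < γ k) ∧ ¬ Summable γ ∧ Summable (fun k => γ k ^ 2)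

/-- `w` is a square-integrable martingale difference noise for `𝓕`, i.e. `E[wₖ₊₁ | 𝓕ₖ] = 0`, with
`E[‖wₖ₊₁‖² | 𝓕ₖ] ≤ c (1 + ‖xₖ‖²)` almost surely for some constant `c`, where
`‖xₖ‖² = ‖x₁ₖ‖² + ‖x₂ₖ‖²`. -/
def IsMartingaleDifferenceNoise {E E₁ E₂ : Type*} [MeasurableSpace Ω] (μ : Measure Ω)
    [NormedAddCommGroup E] [NormedSpace ℝ E] [CompleteSpace E]
    [NormedAddCommGroup E₁] [NormedAddCommGroup E₂]
    (𝓕 : ℕ → MeasurableSpace Ω) (x₁ : ℕ → Ω → E₁) (x₂ : ℕ → Ω → E₂) (w : ℕ → Ω → E) : Prop :=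
  (∀ k, MemLp (w (k + 1)) 2 μ) ∧
  (∀ k, μ[w (k + 1) | 𝓕 k] =ᵐ[μ] 0) ∧
  ∃ c : ℝ, ∀ k, μ[fun ω => ‖w (k + 1) ω‖ ^ 2 | 𝓕 k] ≤ᵐ[μ]
    fun ω => c * (1 + (‖x₁ k ω‖ ^ 2 + ‖x₂ k ω‖ ^ 2))

end Stochastic

end StackelbergGame

end

/-! Since the game is zero-sum, `f` itself supplies Lyapunov functions on both timescales, so the
iterates need not be compared with trajectories of a limiting ODE. The follower's flow is gradient
descent on `-f (y, ·)`; stability forces `r y` to be the global minimizer and the only critical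
point. As `D₂ f` vanishes on the graph of `r`, the envelope theorem identifies `y ↦ G (y, r y)` with
the gradient of the value `φ y = f (y, r y)`, for either form of the total derivative. The same
argument then makes `p` the global minimizer and only critical point of `φ`. At both minima the
Hessian is symmetric and positive semidefinite, and invertibility makes it definite: this is the
equilibrium claim.

On a bounded path `(a, b)`, the gap `f (a, r a) - f (a, b) ≥ 0` decreases at rate `γ₂ ‖D₂ f‖²`, up
to a leader drift of order `γ₁ = o(γ₂)`, noise and second-order terms.
`tendsto_zero_of_stochastic_descent` sends the gap to zero, and compactness gives `b - r a → 0`. The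
leader's direction `G (a, b)` is then a vanishing perturbation of the gradient of `φ`, so the same
lemma applies to `φ a - φ p`. Noise enters linearly through martingale sums, which converge after
truncation to a ball (`ae_exists_tendsto_sum_inner`), and quadratically through series that are
almost surely summable (`ae_summable_sq_mul_norm_sq`). -/

set_option linter.unusedSectionVars false

namespace StackelbergGame

/-! ### First-order expansion with quadratic error; second-order conditions at a minimum. -/

section Calculus

variable {E : Type*} [NormedAddCommGroup E]

theorem apply_le_add_of_lipschitzOnWith_fderiv [NormedSpace ℝ E] {s : Set E} (hs : Convex ℝ s)
    {g : E → ℝ} {g' : E → E →L[ℝ] ℝ} {K : ℝ≥0} (hg : ∀ x ∈ s, HasFDerivAt g (g' x) x)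
    (hK : LipschitzOnWith K g' s) {a b : E} (ha : a ∈ s) (hb : b ∈ s) :
    g b ≤ g a + g' a (b - a) + K * ‖b - a‖ ^ 2 := by
  have hseg : segment ℝ a b ⊆ s := hs.segment_subset ha hb
  -- On the segment `g'` stays within `K * ‖b - a‖` of `g' a`. The mean value inequality then gives
  -- the constant `K`; the sharp `K / 2` is not needed.
  have key := (convex_segment a b).norm_image_sub_le_of_norm_hasFDerivWithin_le'
    (f := g) (f' := g') (φ := g' a) (C := K * ‖b - a‖)
    (fun x hx => (hg x (hseg hx)).hasFDerivWithinAt) (fun x hx => ?_)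
    (left_mem_segment ℝ a b) (right_mem_segment ℝ a b)
  · have := (Real.le_norm_self _).trans key
    nlinarith
  · refine (hK.norm_sub_le (hseg hx) ha).trans ?_
    gcongr
    obtain ⟨t, ht, rfl⟩ := (segment_eq_image' ℝ a b ▸ hx)
    rw [add_sub_cancel_left, norm_smul, Real.norm_of_nonneg ht.1]
    exact mul_le_of_le_one_left (norm_nonneg _) ht.2

variable [InnerProductSpace ℝ E]

/-- A direction of negative curvature would make `g` drop below its minimum along a line, so `H` is
positive semidefinite. A semidefinite symmetric operator kills every vector on which its quadratic
form vanishes, and invertibility leaves only `0`. -/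
theorem isPosDef_of_isMinOn_of_isInvertible [CompleteSpace E] {g : E → ℝ} {g' : E → E} {p : E}
    (hg : ∀ y, HasGradientAt g (g' y) y) (hmin : ∀ y, g p ≤ g y) {H : E →L[ℝ] E}
    (hH : HasFDerivAt g' H p) (hinv : H.IsInvertible) : IsPosDef H := by
  have hp : g' p = 0 := by
    have h : IsLocalMin g p := Eventually.of_forall hmin
    have := h.hasFDerivAt_eq_zero (hg p).hasFDerivAt
    simpa using this
  have hsymm : ∀ v w, inner ℝ (H v) w = inner ℝ v (H w) := by
    intro v w
    let T := (InnerProductSpace.toDual ℝ E).toContinuousLinearEquiv.toContinuousLinearMap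
    have h1 : HasFDerivAt (fun y => T (g' y)) (T ∘L H) p := T.hasFDerivAt.comp p hH
    have := second_derivative_symmetric (fun y => (hg y).hasFDerivAt) h1 v w
    simpa [T, real_inner_comm] using this
  have hpsd : ∀ v, 0 ≤ inner ℝ (H v) v := by
    intro v
    by_contra! hneg
    have hline : ∀ t : ℝ, HasDerivAt (fun t : ℝ => p + t • v) v t := fun t => by
      simpa using ((hasDerivAt_id t).smul_const v).const_add p
    have hd : ∀ t : ℝ, HasDerivAt (fun t : ℝ => g (p + t • v)) (inner ℝ (g' (p + t • v)) v) t := by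
      intro t
      simpa [Function.comp_def] using (hg (p + t • v)).hasFDerivAt.comp_hasDerivAt t (hline t)
    have hk : HasDerivAt (fun t : ℝ => inner ℝ (g' (p + t • v)) v) (inner ℝ (H v) v) 0 := by
      have h0 : HasFDerivAt g' H (p + (0 : ℝ) • v) := by simpa using hH
      simpa using (h0.comp_hasDerivAt (0 : ℝ) (hline 0)).inner ℝ (hasDerivAt_const (0 : ℝ) v)
    have hev : ∀ᶠ t in 𝓝[>] (0 : ℝ), inner ℝ (g' (p + t • v)) v < 0 := by
      have := (hasDerivWithinAt_iff_tendsto_slope' (by simp)).1 (hk.hasDerivWithinAt (s := Set.Ioi 0))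
      filter_upwards [this.eventually_lt_const hneg, self_mem_nhdsWithin] with t ht ht0
      rw [slope_def_field] at ht
      simp only [zero_smul, add_zero, hp, inner_zero_left, sub_zero] at ht
      by_contra! hcon
      exact absurd ht (not_lt.2 (div_nonneg hcon (le_of_lt ht0)))
    obtain ⟨ε, hε, hlt⟩ := (mem_nhdsGT_iff_exists_Ioc_subset).1 hev
    have hanti : StrictAntiOn (fun t : ℝ => g (p + t • v)) (Set.Icc 0 ε) := by
      refine strictAntiOn_of_deriv_neg (convex_Icc 0 ε)
        (fun t _ => (hd t).continuousAt.continuousWithinAt) fun t ht => ?_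
      rw [interior_Icc] at ht
      rw [(hd t).deriv]
      exact hlt ⟨ht.1, ht.2.le⟩
    have hε' : (0 : ℝ) < ε := hε
    have := hanti (Set.left_mem_Icc.2 hε'.le) (Set.right_mem_Icc.2 hε'.le) hε'
    simp only [zero_smul, add_zero] at this
    exact absurd this (not_lt.2 (hmin _))
  refine ⟨hsymm, fun v hv => lt_of_le_of_ne (hpsd v) fun h0 => hv ?_⟩
  obtain ⟨e, rfl⟩ := hinv
  refine e.injective ?_
  rw [map_zero]
  set H : E →L[ℝ] E := (e : E →L[ℝ] E)
  change H v = 0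
  by_contra hne
  have hpos : 0 < inner ℝ (H v) (H v) := real_inner_self_pos.2 hne
  -- The form at `v + t • H v`: the linear term dominates for small negative `t`. In the value of
  -- `t` used below, the `+ 1` keeps the denominator positive even when `b = 0`.
  have hq : ∀ t : ℝ, 0 ≤ 2 * t * inner ℝ (H v) (H v) + t ^ 2 * inner ℝ (H (H v)) (H v) := by
    intro t
    have := hpsd (v + t • H v)
    have h2 : inner ℝ (H (H v)) v = inner ℝ (H v) (H v) := by
      rw [real_inner_comm, ← hsymm]
    simp only [map_add, map_smul, inner_add_left, inner_add_right, inner_smul_left,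
      inner_smul_right, ← h0, h2, RCLike.conj_to_real] at this
    linarith
  set a := inner ℝ (H v) (H v)
  set b := inner ℝ (H (H v)) (H v)
  have hb : 0 ≤ b := hpsd _
  have := hq (-(a / (b + 1)))
  have hb1 : 0 < b + 1 := by linarith
  have e1 : 2 * -(a / (b + 1)) * a + (-(a / (b + 1))) ^ 2 * b =
      -(a ^ 2 * (b + 2)) / (b + 1) ^ 2 := by field_simp; ring
  rw [e1] at this
  have : -(a ^ 2 * (b + 2)) / (b + 1) ^ 2 < 0 :=
    div_neg_of_neg_of_pos (by have := mul_pos (pow_pos hpos 2) (by linarith : 0 < b + 2); linarith)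
      (by positivity)
  linarith

end Calculus

/-! ### Global solutions of Lipschitz ODEs and stable gradient flows. -/

section Flow

variable {E : Type*} [NormedAddCommGroup E]

theorem exists_hasDerivWithinAt_Icc_of_lipschitzWith [NormedSpace ℝ E] [CompleteSpace E]
    {F : E → E} {K : ℝ≥0} (hF : LipschitzWith K F) :
    ∃ T > (0 : ℝ), ∀ x, ∃ α : ℝ → E, α 0 = x ∧
      ∀ t ∈ Set.Icc 0 T, HasDerivWithinAt α (F (α t)) (Set.Icc 0 T) t := by
  -- On the ball of radius `‖F x‖` about `x` the speed is at most `(1 + K) * ‖F x‖`, so this time,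
  -- independent of `x`, is too short to leave it. Uniformity lets local solutions be chained up to
  -- infinity.
  have hT : (0 : ℝ) < 1 / (2 * (K + 1)) := by positivity
  refine ⟨1 / (2 * (K + 1)), hT, fun x => ?_⟩
  have hpl : IsPicardLindelof (fun _ => F) (⟨0, Set.left_mem_Icc.2 hT.le⟩ : Set.Icc _ _) x
      ‖F x‖₊ 0 (‖F x‖₊ + K * ‖F x‖₊) K := by
    refine IsPicardLindelof.of_time_independent (fun y hy => ?_) (hF.lipschitzOnWith) ?_
    · have h1 : ‖F y - F x‖ ≤ K * ‖F x‖ := by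
        refine (hF.norm_sub_le y x).trans ?_
        gcongr
        simpa [dist_eq_norm] using hy
      have h2 : ‖F y‖ ≤ ‖F y - F x‖ + ‖F x‖ := by
        simpa using norm_add_le (F y - F x) (F x)
      push_cast
      linarith
    · simp only [sub_self, NNReal.coe_add, NNReal.coe_mul, coe_nnnorm, NNReal.coe_zero, sub_zero,
        max_eq_left hT.le]
      rw [mul_one_div, div_le_iff₀ (by positivity)]
      have := norm_nonneg (F x)
      have hK : (0 : ℝ) ≤ K := K.2
      nlinarith [mul_nonneg hK this]
  exact hpl.exists_eq_forall_mem_Icc_hasDerivWithinAt₀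

theorem exists_isForwardSolution_of_lipschitzWith [NormedSpace ℝ E] [CompleteSpace E]
    {F : E → E} {K : ℝ≥0} (hF : LipschitzWith K F) (x : E) :
    ∃ y : ℝ → E, y 0 = x ∧ IsForwardSolution F y := by
  obtain ⟨T, hT, hloc⟩ := exists_hasDerivWithinAt_Icc_of_lipschitzWith hF
  choose Φ hΦ0 hΦ using hloc
  let X : ℕ → E := fun n => Nat.rec x (fun _ z => Φ z T) n
  have hX : ∀ n, X (n + 1) = Φ (X n) T := fun n => rfl
  let y : ℝ → E := fun t => Φ (X ⌊t / T⌋₊) (t - ⌊t / T⌋₊ * T)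
  have hy : ∀ n : ℕ, ∀ t ∈ Set.Icc (n * T) ((n + 1) * T), y t = Φ (X n) (t - n * T) := by
    intro n t ht
    rcases ht.2.lt_or_eq with h | h
    · have : ⌊t / T⌋₊ = n := by
        rw [Nat.floor_eq_iff (div_nonneg ((by positivity : (0 : ℝ) ≤ n * T).trans ht.1) hT.le)]
        exact ⟨(le_div_iff₀ hT).2 ht.1, (div_lt_iff₀ hT).2 h⟩
      simp only [y, this]
    · have : ⌊t / T⌋₊ = n + 1 := by
        rw [h, mul_div_cancel_right₀ _ hT.ne']
        exact_mod_cast Nat.floor_natCast (n + 1)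
      simp only [y, this, hX]
      rw [h]
      push_cast
      rw [sub_self, hΦ0]
      congr 1
      ring
  have hd : ∀ n : ℕ, ∀ t ∈ Set.Icc (n * T) ((n + 1) * T),
      HasDerivWithinAt y (F (y t)) (Set.Icc (n * T) ((n + 1) * T)) t := by
    intro n t ht
    have hmaps : Set.MapsTo (fun s : ℝ => s - n * T) (Set.Icc (n * T) ((n + 1) * T))
        (Set.Icc 0 T) := fun s hs => ⟨by linarith [hs.1], by nlinarith [hs.2]⟩
    have h1 : HasDerivWithinAt (fun s : ℝ => s - n * T) 1 (Set.Icc (n * T) ((n + 1) * T)) t :=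
      ((hasDerivAt_id t).sub_const _).hasDerivWithinAt
    have h2 := (hΦ (X n) _ (hmaps ht)).scomp t h1 hmaps
    rw [one_smul, ← hy n t ht] at h2
    exact h2.congr (fun s hs => hy n s hs) (hy n t ht)
  refine ⟨y, by simp [y, hΦ0, X], fun t ht => ?_⟩
  have ht : 0 ≤ t := ht
  set n := ⌊t / T⌋₊ with hn
  have hn1 : n * T ≤ t := (le_div_iff₀ hT).1 (Nat.floor_le (div_nonneg ht hT.le))
  have hn2 : t < (n + 1) * T := (div_lt_iff₀ hT).1 (Nat.lt_floor_add_one _)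
  have hdn := hd n t ⟨hn1, hn2.le⟩
  rcases hn1.lt_or_eq with hlt | heq
  · exact (hdn.hasDerivAt (Icc_mem_nhds hlt hn2)).hasDerivWithinAt
  -- At a grid point the two adjacent pieces give the one-sided derivatives, with the same value `F
  -- (y t)`; at `t = 0` only the right one is required.
  have hright : HasDerivWithinAt y (F (y t)) (Set.Ici t) t := by
    rw [heq] at hdn
    exact hdn.mono_of_mem_nhdsWithin (Icc_mem_nhdsGE hn2)
  rcases Nat.eq_zero_or_pos n with h0 | hpos
  · rw [h0, Nat.cast_zero, zero_mul] at heq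
    rwa [← heq] at hright ⊢
  · obtain ⟨m, hm⟩ := Nat.exists_eq_succ_of_ne_zero hpos.ne'
    have hmt : (m + 1) * T = t := by rw [← heq, hm]; push_cast; ring
    have hdm := hd m t ⟨by nlinarith, hmt.ge⟩
    rw [hmt] at hdm
    have hleft : HasDerivWithinAt y (F (y t)) (Set.Iic t) t :=
      hdm.mono_of_mem_nhdsWithin (Icc_mem_nhdsLE (by nlinarith))
    have := hleft.union hright
    rw [Set.Iic_union_Ici, hasDerivWithinAt_univ] at this
    exact this.hasDerivWithinAt

theorem IsGloballyAsymptoticallyStable.eq_of_apply_eq_zero [NormedSpace ℝ E] {F : E → E} {p y : E}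
    (h : IsGloballyAsymptoticallyStable F p) (hy : F y = 0) : y = p :=
  tendsto_nhds_unique tendsto_const_nhds
    (h.2.2 (fun _ => y) fun t _ => by simpa [hy] using hasDerivWithinAt_const t _ y)

/-- Along the flow from `x` the derivative of `g` is `-‖g'‖²`, so `g` never exceeds `g x`; the flow
ends at `p`. The Lipschitz bound serves to produce a solution from every `x`, since stability alone
speaks only of existing ones. -/
theorem IsGloballyAsymptoticallyStable.apply_le_of_hasGradientAt [InnerProductSpace ℝ E]
    [CompleteSpace E] {g : E → ℝ} {g' : E → E} {p : E} {K : ℝ≥0}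
    (h : IsGloballyAsymptoticallyStable (fun y => -g' y) p)
    (hg : ∀ y, HasGradientAt g (g' y) y) (hK : LipschitzWith K g') (x : E) : g p ≤ g x := by
  obtain ⟨y, rfl, hy⟩ := exists_isForwardSolution_of_lipschitzWith hK.neg x
  have hd : ∀ t ∈ Set.Ici (0 : ℝ),
      HasDerivWithinAt (fun t => g (y t)) (-‖g' (y t)‖ ^ 2) (Set.Ici 0) t := by
    intro t ht
    simpa [Function.comp_def] using (hg (y t)).hasFDerivAt.comp_hasDerivWithinAt t (hy t ht)
  have hanti : AntitoneOn (fun t => g (y t)) (Set.Ici 0) := by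
    refine antitoneOn_of_deriv_nonpos (convex_Ici 0)
      (fun t ht => (hd t ht).continuousWithinAt) (fun t ht => ?_) fun t ht => ?_
    all_goals
      have h1 := (hd t (interior_subset ht)).hasDerivAt (mem_interior_iff_mem_nhds.1 ht)
    · exact h1.differentiableAt.differentiableWithinAt
    · rw [h1.deriv]
      simp
  refine le_of_tendsto ((hg p).continuousAt.tendsto.comp (h.2.2 y hy)) ?_
  filter_upwards [eventually_ge_atTop 0] with t ht
  exact hanti Set.self_mem_Ici ht ht

end Flow

/-! ### The reaction map, the value function and the equilibrium conditions. -/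

section Game

variable {E₁ E₂ : Type*}
  [NormedAddCommGroup E₁] [InnerProductSpace ℝ E₁] [CompleteSpace E₁]
  [NormedAddCommGroup E₂] [InnerProductSpace ℝ E₂] [CompleteSpace E₂]
  {f g : E₁ × E₂ → ℝ} {r : E₁ → E₂} {G : E₁ × E₂ → E₁}

theorem grad₂_eq_toDual_symm {x : E₁ × E₂} (hg : DifferentiableAt ℝ g x) :
    grad₂ g x = (InnerProductSpace.toDual ℝ E₂).symm (fderiv ℝ g x ∘L .inr ℝ E₁ E₂) := by
  have : HasFDerivAt (fun z => g (x.1, z)) (fderiv ℝ g x ∘L .inr ℝ E₁ E₂) x.2 :=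
    HasFDerivAt.comp (g := g) x.2 hg.hasFDerivAt (hasFDerivAt_prodMk_right x.1 x.2)
  rw [grad₂, gradient, this.fderiv]

theorem grad₁_eq_toDual_symm {x : E₁ × E₂} (hg : DifferentiableAt ℝ g x) :
    grad₁ g x = (InnerProductSpace.toDual ℝ E₁).symm (fderiv ℝ g x ∘L .inl ℝ E₁ E₂) := by
  have : HasFDerivAt (fun y => g (y, x.2)) (fderiv ℝ g x ∘L .inl ℝ E₁ E₂) x.1 :=
    HasFDerivAt.comp (g := g) x.1 hg.hasFDerivAt (hasFDerivAt_prodMk_left x.1 x.2)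
  rw [grad₁, gradient, this.fderiv]

theorem fderiv_apply_eq_inner_grad {x : E₁ × E₂} (hg : DifferentiableAt ℝ g x) (u : E₁ × E₂) :
    fderiv ℝ g x u = inner ℝ (grad₁ g x) u.1 + inner ℝ (grad₂ g x) u.2 := by
  rw [grad₁_eq_toDual_symm hg, grad₂_eq_toDual_symm hg, InnerProductSpace.toDual_symm_apply,
    InnerProductSpace.toDual_symm_apply]
  simp [← map_add]

theorem grad₂_neg (x : E₁ × E₂) : grad₂ (-g) x = -grad₂ g x := by
  have : (fun z => (-g) (x.1, z)) = -fun z => g (x.1, z) := rfl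
  rw [grad₂, grad₂, gradient, gradient, this, fderiv_neg, map_neg]

theorem contDiff_grad₂ (hg : ContDiff ℝ 2 g) : ContDiff ℝ 1 (grad₂ g) := by
  have hd := hg.differentiable two_ne_zero
  rw [show grad₂ g = _ from funext fun x => grad₂_eq_toDual_symm (hd x)]
  have := hg.fderiv_right (m := 1) (by norm_num)
  exact (InnerProductSpace.toDual ℝ E₂).symm.contDiff.comp (this.clm_comp contDiff_const)

theorem contDiff_grad₁ (hg : ContDiff ℝ 2 g) : ContDiff ℝ 1 (grad₁ g) := by
  have hd := hg.differentiable two_ne_zero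
  rw [show grad₁ g = _ from funext fun x => grad₁_eq_toDual_symm (hd x)]
  have := hg.fderiv_right (m := 1) (by norm_num)
  exact (InnerProductSpace.toDual ℝ E₁).symm.contDiff.comp (this.clm_comp contDiff_const)

theorem hasGradientAt_grad₂ (hg : Differentiable ℝ g) (y : E₁) (z : E₂) :
    HasGradientAt (fun z => g (y, z)) (grad₂ g (y, z)) z :=
  ((hg (y, z)).comp z (by fun_prop)).hasGradientAt

theorem hasFDerivAt_hess₂ (hg : ContDiff ℝ 2 g) (y : E₁) (z : E₂) :
    HasFDerivAt (fun z => grad₂ g (y, z)) (hess₂ g (y, z)) z :=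
  (((contDiff_grad₂ hg).differentiable one_ne_zero (y, z)).comp z
    (by fun_prop)).hasFDerivAt

theorem hess₂_eq_fderiv_comp_inr (hg : ContDiff ℝ 2 g) (x : E₁ × E₂) :
    hess₂ g x = fderiv ℝ (grad₂ g) x ∘L .inr ℝ E₁ E₂ :=
  (HasFDerivAt.comp (g := grad₂ g) x.2
    ((contDiff_grad₂ hg).differentiable one_ne_zero x).hasFDerivAt
    (hasFDerivAt_prodMk_right x.1 x.2)).fderiv

theorem IsLeaderField.isInvertible_hess₂ {f₂ : E₁ × E₂ → ℝ} (hG : IsLeaderField f f₂ r G) (y : E₁) :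
    (hess₂ f₂ (y, r y)).IsInvertible := by
  rcases hG with h | h
  exacts [h.1 _, h.1 y]

theorem gradAlong_eq_grad₁ {S : E₁ →L[ℝ] E₂} {x : E₁ × E₂} (h : grad₂ f x = 0) :
    gradAlong f S x = grad₁ f x := by
  simp [gradAlong, h]

theorem IsLeaderField.apply_eq_grad₁ {f₂ : E₁ × E₂ → ℝ} (hG : IsLeaderField f f₂ r G) {y : E₁}
    (h : grad₂ f (y, r y) = 0) : G (y, r y) = grad₁ f (y, r y) := by
  rcases hG with h' | h' <;> rw [h'.2]
  exacts [gradAlong_eq_grad₁ h, gradAlong_eq_grad₁ h]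

/-- Continuity keeps the graph of `r` in the neighbourhood where the implicit function theorem has a
unique solution, so `r` agrees locally with the implicit function. -/
theorem contDiffAt_of_grad₂_eq_zero (hg : ContDiff ℝ 2 g) (hr : Continuous r)
    (h0 : ∀ y, grad₂ g (y, r y) = 0) {y : E₁} (hinv : (hess₂ g (y, r y)).IsInvertible) :
    ContDiffAt ℝ 1 r y := by
  rw [hess₂_eq_fderiv_comp_inr hg] at hinv
  have hc : ContDiffAt ℝ 1 (grad₂ g) (y, r y) := (contDiff_grad₂ hg).contDiffAt
  refine (hc.contDiffAt_implicitFunction one_ne_zero hinv).congr_of_eventuallyEq ?_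
  have ht : Tendsto (fun y' => (y', r y')) (𝓝 y) (𝓝 (y, r y)) :=
    (continuous_id.prodMk hr).tendsto y
  filter_upwards [ht.eventually (hc.eventually_apply_eq_iff_implicitFunction one_ne_zero hinv)]
    with y' hy'
  exact (hy'.1 (by rw [h0, h0])).symm

/-- Envelope theorem: the chain-rule term through `r` is paired with `grad₂ f`, which vanishes. -/
theorem hasGradientAt_apply_reaction (hf : Differentiable ℝ f) {y : E₁}
    (hr : DifferentiableAt ℝ r y) (h0 : grad₂ f (y, r y) = 0) :
    HasGradientAt (fun y => f (y, r y)) (grad₁ f (y, r y)) y := by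
  have h1 : HasFDerivAt (fun y => f (y, r y))
      (fderiv ℝ f (y, r y) ∘L (ContinuousLinearMap.id ℝ E₁).prod (fderiv ℝ r y)) y :=
    HasFDerivAt.comp (g := f) y (hf _).hasFDerivAt ((hasFDerivAt_id y).prodMk hr.hasFDerivAt)
  rw [hasGradientAt_iff_hasFDerivAt]
  suffices h2 : InnerProductSpace.toDual ℝ E₁ (grad₁ f (y, r y)) =
      fderiv ℝ f (y, r y) ∘L (ContinuousLinearMap.id ℝ E₁).prod (fderiv ℝ r y) from h2 ▸ h1
  ext u
  simp [fderiv_apply_eq_inner_grad (hf _), h0]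

/-- The hypotheses on the zero-sum game `(f, -f)`: the follower's gradient flow has a globally
asymptotically stable equilibrium `r y` for each action `y` of the leader, `G` is the leader's total
derivative, and the leader's reduced dynamics have the globally asymptotically stable equilibrium
`p`. -/
structure IsStableZeroSumGame (f : E₁ × E₂ → ℝ) (r : E₁ → E₂) (G : E₁ × E₂ → E₁) (p : E₁) :
    Prop where
  contDiff : ContDiff ℝ 2 f
  lipschitz_reaction : ∃ L : ℝ≥0, LipschitzWith L r
  stable_follower : ∀ y, IsGloballyAsymptoticallyStable (fun z => -grad₂ (-f) (y, z)) (r y)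
  isLeaderField : IsLeaderField f (-f) r G
  lipschitz_leader : ∃ L : ℝ≥0, LipschitzWith L G
  lipschitz_follower : ∃ L : ℝ≥0, LipschitzWith L (grad₂ (-f))
  stable_leader : IsGloballyAsymptoticallyStable (fun y => -G (y, r y)) p

namespace IsStableZeroSumGame

variable {p : E₁} (h : IsStableZeroSumGame f r G p)
include h

theorem continuous_reaction : Continuous r :=
  h.lipschitz_reaction.choose_spec.continuous

theorem continuous_leader : Continuous G :=
  h.lipschitz_leader.choose_spec.continuous

theorem differentiable : Differentiable ℝ f :=
  h.contDiff.differentiable two_ne_zero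

theorem contDiff_neg : ContDiff ℝ 2 (-f) :=
  h.contDiff.neg

theorem grad₂_neg_reaction (y : E₁) : grad₂ (-f) (y, r y) = 0 := by
  simpa using (h.stable_follower y).1

theorem grad₂_reaction (y : E₁) : grad₂ f (y, r y) = 0 := by
  simpa [grad₂_neg] using h.grad₂_neg_reaction y

theorem eq_reaction_of_grad₂_neg_eq_zero {y : E₁} {z : E₂} (hz : grad₂ (-f) (y, z) = 0) :
    z = r y :=
  (h.stable_follower y).eq_of_apply_eq_zero (by simp [hz])

theorem contDiff_reaction : ContDiff ℝ 1 r :=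
  contDiff_iff_contDiffAt.2 fun y => contDiffAt_of_grad₂_eq_zero h.contDiff_neg
    h.continuous_reaction h.grad₂_neg_reaction (h.isLeaderField.isInvertible_hess₂ y)

theorem leader_eq_grad₁ (y : E₁) : G (y, r y) = grad₁ f (y, r y) :=
  h.isLeaderField.apply_eq_grad₁ (h.grad₂_reaction y)

theorem hasGradientAt_value (y : E₁) :
    HasGradientAt (fun y => f (y, r y)) (G (y, r y)) y := by
  rw [h.leader_eq_grad₁]
  exact hasGradientAt_apply_reaction h.differentiable
    (h.contDiff_reaction.differentiable one_ne_zero y) (h.grad₂_reaction y)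

theorem lipschitz_reduced : ∃ L : ℝ≥0, LipschitzWith L fun y => G (y, r y) := by
  obtain ⟨L, hL⟩ := h.lipschitz_reaction
  obtain ⟨L', hL'⟩ := h.lipschitz_leader
  exact ⟨_, hL'.comp (LipschitzWith.id.prodMk hL)⟩

theorem neg_apply_reaction_le (y : E₁) (z : E₂) : (-f) (y, r y) ≤ (-f) (y, z) := by
  obtain ⟨L, hL⟩ := h.lipschitz_follower
  exact (h.stable_follower y).apply_le_of_hasGradientAt
    (hasGradientAt_grad₂ (h.contDiff_neg.differentiable two_ne_zero) y)
    (hL.comp (LipschitzWith.prodMk_left y)) z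

theorem apply_le_apply_reaction (y : E₁) (z : E₂) : f (y, z) ≤ f (y, r y) := by
  simpa using h.neg_apply_reaction_le y z

theorem value_le (y : E₁) : f (p, r p) ≤ f (y, r y) := by
  obtain ⟨L, hL⟩ := h.lipschitz_reduced
  exact h.stable_leader.apply_le_of_hasGradientAt h.hasGradientAt_value hL y

theorem eq_of_leader_eq_zero {y : E₁} (hy : G (y, r y) = 0) : y = p :=
  h.stable_leader.eq_of_apply_eq_zero (by simp [hy])

theorem eq_reaction_of_apply_eq {y : E₁} {z : E₂} (hz : f (y, z) = f (y, r y)) : z = r y := by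
  refine h.eq_reaction_of_grad₂_neg_eq_zero ?_
  have hmin : IsLocalMin (fun z => (-f) (y, z)) z := Eventually.of_forall fun z' => by
    simpa [hz] using h.apply_le_apply_reaction y z'
  simpa using hmin.hasFDerivAt_eq_zero
    (hasGradientAt_grad₂ (h.contDiff_neg.differentiable two_ne_zero) y z).hasFDerivAt

theorem eq_of_value_eq {y : E₁} (hy : f (y, r y) = f (p, r p)) : y = p := by
  refine h.eq_of_leader_eq_zero ?_
  have hmin : IsLocalMin (fun y => f (y, r y)) y := Eventually.of_forall fun y' => by
    simpa [hy] using h.value_le y'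
  simpa using hmin.hasFDerivAt_eq_zero (h.hasGradientAt_value y).hasFDerivAt

theorem isDifferentialStackelberg (hinv : (fderiv ℝ (fun y => G (y, r y)) p).IsInvertible) :
    IsDifferentialStackelberg f (-f) (p, r p) := by
  have htotal : ∀ y, totalGrad f (-f) (y, r y) = G (y, r y) := fun y => by
    rw [h.leader_eq_grad₁, totalGrad, gradAlong_eq_grad₁ (h.grad₂_reaction y)]
  have hd : DifferentiableAt ℝ (fun y => G (y, r y)) p := by
    rw [funext h.leader_eq_grad₁]
    exact ((contDiff_grad₁ h.contDiff).comp
      (contDiff_id.prodMk h.contDiff_reaction)).differentiable one_ne_zero p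
  refine ⟨isPosDef_of_isMinOn_of_isInvertible
      (hasGradientAt_grad₂ (h.contDiff_neg.differentiable two_ne_zero) p)
      (h.neg_apply_reaction_le p) (hasFDerivAt_hess₂ h.contDiff_neg p (r p))
      (h.isLeaderField.isInvertible_hess₂ p),
    r, h.contDiff_reaction.contDiffAt, rfl, Eventually.of_forall h.grad₂_neg_reaction, ?_,
    fderiv ℝ (fun y => G (y, r y)) p, ?_,
    isPosDef_of_isMinOn_of_isInvertible h.hasGradientAt_value h.value_le hd.hasFDerivAt hinv⟩
  · simpa [htotal] using h.stable_leader.1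
  · simpa only [htotal] using hd.hasFDerivAt

end IsStableZeroSumGame

end Game

/-! ### Deterministic descent with vanishing errors, and compactness. -/

section Descent

/-- A Robbins–Siegmund-type argument for one path. Adding the tail of the noise series to `v`
absorbs `ξ`. The corrected sequence must fall below any level because `∑ γ` diverges, and it cannot
climb back because single steps overshoot by little. -/
theorem tendsto_zero_of_stochastic_descent {v ψ γ ε ξ : ℕ → ℝ} (hv : ∀ k, 0 ≤ v k)
    (hγ : IsLearningRate γ) (hε : Tendsto ε atTop (𝓝 0)) (hψ : ∀ k, 0 ≤ ψ k)
    (hξ : ∃ l, Tendsto (fun n => ∑ i ∈ Finset.range n, ξ i) atTop (𝓝 l))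
    (hstep : ∀ k, v (k + 1) ≤ v k - γ k * (ψ k - ε k) + ξ k)
    (hpos : ∀ δ > 0, ∃ c > 0, ∀ k, δ ≤ v k → c ≤ ψ k) : Tendsto v atTop (𝓝 0) := by
  obtain ⟨hγ0, hγ1, hγ2⟩ := hγ
  obtain ⟨l, hl⟩ := hξ
  have hγ_lim : Tendsto γ atTop (𝓝 0) := by
    have := (Real.continuous_sqrt.tendsto 0).comp hγ2.tendsto_atTop_zero
    simpa [Function.comp_def, Real.sqrt_sq (hγ0 _).le] using this
  let τ : ℕ → ℝ := fun k => l - ∑ i ∈ Finset.range k, ξ i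
  have hτ : Tendsto τ atTop (𝓝 0) := by simpa [τ] using hl.const_sub l
  let u : ℕ → ℝ := fun k => v k + τ k
  have hu : ∀ k, u (k + 1) ≤ u k - γ k * (ψ k - ε k) := by
    intro k
    have := hstep k
    simp only [u, τ, Finset.sum_range_succ]
    linarith
  suffices key : ∀ δ > 0, ∀ᶠ k in atTop, v k ≤ 4 * δ by
    rw [Metric.tendsto_atTop']
    intro η hη
    obtain ⟨N, hN⟩ := eventually_atTop.1 (key (η / 8) (by positivity))
    refine ⟨N, fun k hk => ?_⟩
    rw [Real.dist_eq, sub_zero, abs_of_nonneg (hv k)]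
    linarith [hN k hk.le]
  intro δ hδ
  obtain ⟨c, hc, hcψ⟩ := hpos δ hδ
  have hγε : Tendsto (fun k => γ k * ε k) atTop (𝓝 0) := by simpa using hγ_lim.mul hε
  -- Budget after `N`: `u` starts at most `2 * δ`, one step adds at most `δ` through `γ * ε`, and
  -- returning from `u` to `v` costs `|τ| < δ`, giving `4 * δ`. The bound `ε < c / 2` leaves half
  -- the decrease.
  obtain ⟨N, hN⟩ := eventually_atTop.1
    (((hτ.abs.eventually (gt_mem_nhds (by simpa using hδ))).and
      (hε.eventually (gt_mem_nhds (half_pos hc)))).and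
      (hγε.eventually (gt_mem_nhds hδ)))
  have hlarge : ∀ k ≥ N, 2 * δ ≤ u k → u (k + 1) ≤ u k - γ k * (c / 2) := by
    intro k hk huk
    obtain ⟨⟨h1, h2⟩, -⟩ := hN k hk
    have h3 : δ ≤ v k := by
      have := (abs_lt.1 h1).2
      simp only [u] at huk
      linarith
    have h4 : γ k * (c / 2) ≤ γ k * (ψ k - ε k) :=
      mul_le_mul_of_nonneg_left (by linarith [hcψ k h3]) (hγ0 k).le
    linarith [hu k]
  have hsmall : ∀ k ≥ N, u k ≤ 2 * δ → u (k + 1) ≤ 3 * δ := by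
    intro k hk huk
    have h1 := (hN k hk).2
    have h2 := mul_nonneg (hγ0 k).le (hψ k)
    have := hu k
    rw [mul_sub] at this
    linarith
  -- Otherwise every step loses `γ k * (c / 2)` while `u` stays positive, making `γ` summable.
  obtain ⟨n, hn, hun⟩ : ∃ n ≥ N, u n ≤ 2 * δ := by
    by_contra! hcon
    refine hγ1 ((summable_nat_add_iff N).1
      (summable_of_sum_range_le (c := u N / (c / 2)) (fun k => (hγ0 _).le) fun n => ?_))
    rw [le_div_iff₀ (half_pos hc)]
    have hsum : ∀ n, (∑ i ∈ Finset.range n, γ (i + N)) * (c / 2) ≤ u N - u (n + N) := by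
      intro n
      induction n with
      | zero => simp
      | succ n ih =>
        have := hlarge (n + N) (by omega) (hcon _ (by omega)).le
        rw [Finset.sum_range_succ, add_mul, show n + 1 + N = n + N + 1 by omega]
        linarith
    linarith [hsum n, hcon (n + N) (by omega)]
  filter_upwards [eventually_ge_atTop n] with k hk
  have huk : u k ≤ 3 * δ := by
    induction k, hk using Nat.le_induction with
    | base => linarith
    | succ k hk ih =>
      rcases le_total (u k) (2 * δ) with h | h
      · exact hsmall k (hn.trans hk) h
      · have := hlarge k (hn.trans hk) h
        have := mul_pos (hγ0 k) (half_pos hc)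
        linarith
  have := (abs_lt.1 (hN k (hn.trans hk)).1.1).1
  simp only [u] at huk
  linarith

theorem exists_pos_le_of_isCompact {X : Type*} [TopologicalSpace X] {K : Set X} (hK : IsCompact K)
    {V W : X → ℝ} (hV : Continuous V) (hW : Continuous W) (h : ∀ x ∈ K, V x ≤ 0 → W x ≤ 0)
    {δ : ℝ} (hδ : 0 < δ) : ∃ c > 0, ∀ x ∈ K, δ ≤ W x → c ≤ V x := by
  have hK' : IsCompact (K ∩ {x | δ ≤ W x}) := hK.inter_right (isClosed_le continuous_const hW)
  rcases (K ∩ {x | δ ≤ W x}).eq_empty_or_nonempty with he | hne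
  · exact ⟨1, one_pos, fun x hx hx' => absurd (he ▸ ⟨hx, hx'⟩ : x ∈ (∅ : Set X)) (by simp)⟩
  · obtain ⟨x, hx, hmin⟩ := hK'.exists_isMinOn hne hV.continuousOn
    refine ⟨V x, ?_, fun y hy hy' => hmin ⟨hy, hy'⟩⟩
    by_contra! hcon
    exact absurd (h x hx.1 hcon) (not_le.2 (hδ.trans_le hx.2))

theorem tendsto_zero_of_isCompact {X : Type*} [TopologicalSpace X] {K : Set X} (hK : IsCompact K)
    {V W : X → ℝ} (hV : Continuous V) (hW : Continuous W) (h : ∀ x ∈ K, V x ≤ 0 → W x ≤ 0)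
    (hW0 : ∀ x, 0 ≤ W x) {x : ℕ → X} (hx : ∀ k, x k ∈ K)
    (hlim : Tendsto (fun k => V (x k)) atTop (𝓝 0)) : Tendsto (fun k => W (x k)) atTop (𝓝 0) := by
  refine tendsto_order.2 ⟨fun a ha => Eventually.of_forall fun k => ha.trans_le (hW0 _),
    fun δ hδ => ?_⟩
  obtain ⟨c, hc, hle⟩ := exists_pos_le_of_isCompact hK hV hW h hδ
  filter_upwards [hlim.eventually (gt_mem_nhds hc)] with k hk
  by_contra! hcon
  exact absurd (hle _ (hx k) hcon) (not_le.2 hk)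

theorem summable_norm_sq_step {E : Type*} [NormedAddCommGroup E] [NormedSpace ℝ E] {γ : ℕ → ℝ}
    {u m : ℕ → E} {B : ℝ} (hγ : Summable fun k => γ k ^ 2) (hu : ∀ k, ‖u k‖ ≤ B)
    (hm : Summable fun k => γ k ^ 2 * ‖m k‖ ^ 2) :
    Summable fun k => ‖γ k • (u k + m k)‖ ^ 2 := by
  refine Summable.of_nonneg_of_le (fun k => sq_nonneg _) (fun k => ?_)
    (((hγ.mul_right (B ^ 2)).add hm).mul_left 2)
  rw [norm_smul, mul_pow, Real.norm_eq_abs, sq_abs]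
  have h1 : ‖u k + m k‖ ^ 2 ≤ (B + ‖m k‖) ^ 2 := by
    gcongr
    exact (norm_add_le _ _).trans (by linarith [hu k])
  have h2 : (B + ‖m k‖) ^ 2 ≤ 2 * (B ^ 2 + ‖m k‖ ^ 2) := by nlinarith [sq_nonneg (B - ‖m k‖)]
  calc γ k ^ 2 * ‖u k + m k‖ ^ 2 ≤ γ k ^ 2 * (2 * (B ^ 2 + ‖m k‖ ^ 2)) := by
        gcongr
        exact h1.trans h2
    _ = _ := by ring

theorem exists_lipschitzOnWith_of_contDiff {E F : Type*} [NormedAddCommGroup E] [NormedSpace ℝ E]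
    [NormedAddCommGroup F] [NormedSpace ℝ F] {h : E → F} (hh : ContDiff ℝ 1 h) {K : Set E}
    (hK : IsCompact K) (hconv : Convex ℝ K) : ∃ C : ℝ≥0, LipschitzOnWith C h K := by
  obtain ⟨C, hC⟩ := hK.exists_bound_of_continuousOn
    (hh.continuous_fderiv one_ne_zero).continuousOn
  refine ⟨C.toNNReal, hconv.lipschitzOnWith_of_nnnorm_fderiv_le
    (fun x _ => hh.differentiable one_ne_zero x) fun x hx => ?_⟩
  rw [← NNReal.coe_le_coe, coe_nnnorm]
  exact (hC x hx).trans (Real.le_coe_toNNReal C)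

theorem exists_tendsto_sum_add {ξ ζ : ℕ → ℝ}
    (hξ : ∃ l, Tendsto (fun n => ∑ i ∈ Finset.range n, ξ i) atTop (𝓝 l))
    (hζ : ∃ l, Tendsto (fun n => ∑ i ∈ Finset.range n, ζ i) atTop (𝓝 l)) :
    ∃ l, Tendsto (fun n => ∑ i ∈ Finset.range n, (ξ i + ζ i)) atTop (𝓝 l) := by
  obtain ⟨l, hl⟩ := hξ
  obtain ⟨l', hl'⟩ := hζ
  exact ⟨l + l', by simpa only [Finset.sum_add_distrib] using hl.add hl'⟩

theorem exists_tendsto_sum_neg {ξ : ℕ → ℝ}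
    (hξ : ∃ l, Tendsto (fun n => ∑ i ∈ Finset.range n, ξ i) atTop (𝓝 l)) :
    ∃ l, Tendsto (fun n => ∑ i ∈ Finset.range n, -ξ i) atTop (𝓝 l) := by
  obtain ⟨l, hl⟩ := hξ
  exact ⟨-l, by simpa only [Finset.sum_neg_distrib] using hl.neg⟩

end Descent

/-! ### Convergence along one bounded path. -/

section Path

variable {E₁ E₂ : Type*}
  [NormedAddCommGroup E₁] [InnerProductSpace ℝ E₁] [FiniteDimensional ℝ E₁] [CompleteSpace E₁]
  [NormedAddCommGroup E₂] [InnerProductSpace ℝ E₂] [FiniteDimensional ℝ E₂] [CompleteSpace E₂]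
  {f : E₁ × E₂ → ℝ} {r : E₁ → E₂} {G : E₁ × E₂ → E₁} {p : E₁}

/-- The coefficient of the leader's noise in the first-order expansion of the follower's
optimality gap `f (y, r y) - f (y, z)`. -/
noncomputable def gapGrad₁ (f : E₁ × E₂ → ℝ) (r : E₁ → E₂) (G : E₁ × E₂ → E₁) (x : E₁ × E₂) : E₁ :=
  G (x.1, r x.1) + grad₁ (-f) x

/-- A bounded run `(a, b)` of the two-timescale recursion with noises `m`, `n` whose weighted
sums converge. -/
structure IsTameRun (f : E₁ × E₂ → ℝ) (r : E₁ → E₂) (G : E₁ × E₂ → E₁) (γ₁ γ₂ : ℕ → ℝ)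
    (a m : ℕ → E₁) (b n : ℕ → E₂) : Prop where
  bounded : ∃ R, ∀ k, (a k, b k) ∈ Metric.closedBall (0 : E₁ × E₂) R
  step₁ : ∀ k, a (k + 1) = a k - γ₁ k • (G (a k, b k) + m k)
  step₂ : ∀ k, b (k + 1) = b k - γ₂ k • (grad₂ (-f) (a k, b k) + n k)
  summable₁ : Summable fun k => γ₁ k ^ 2 * ‖m k‖ ^ 2
  summable₂ : Summable fun k => γ₂ k ^ 2 * ‖n k‖ ^ 2
  tendsto_gap : ∃ l, Tendsto (fun N => ∑ k ∈ Finset.range N,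
    γ₁ k * inner ℝ (gapGrad₁ f r G (a k, b k)) (m k)) atTop (𝓝 l)
  tendsto_follower : ∃ l, Tendsto (fun N => ∑ k ∈ Finset.range N,
    γ₂ k * inner ℝ (grad₂ (-f) (a k, b k)) (n k)) atTop (𝓝 l)
  tendsto_leader : ∃ l, Tendsto (fun N => ∑ k ∈ Finset.range N,
    γ₁ k * inner ℝ (G (a k, r (a k))) (m k)) atTop (𝓝 l)

namespace IsStableZeroSumGame

variable (h : IsStableZeroSumGame f r G p)
include h

theorem value_step : ∃ L : ℝ, 0 ≤ L ∧ ∀ y y', f (y', r y') ≤ f (y, r y) +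
    inner ℝ (G (y, r y)) (y' - y) + L * ‖y' - y‖ ^ 2 := by
  obtain ⟨L, hL⟩ := h.lipschitz_reduced
  refine ⟨L, L.2, fun y y' => ?_⟩
  have hL' : LipschitzWith L fun y => InnerProductSpace.toDual ℝ E₁ (G (y, r y)) := by
    simpa [Function.comp_def] using (InnerProductSpace.toDual ℝ E₁).lipschitz.comp hL
  simpa using apply_le_add_of_lipschitzOnWith_fderiv convex_univ
    (fun y _ => (h.hasGradientAt_value y).hasFDerivAt) hL'.lipschitzOnWith
    (Set.mem_univ y) (Set.mem_univ y')

/-- `f` is only `C²`, and the full derivative is not assumed globally Lipschitz, so the constant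
comes from compactness of the ball. -/
theorem neg_step (R : ℝ) : ∃ L : ℝ, 0 ≤ L ∧ ∀ x ∈ Metric.closedBall (0 : E₁ × E₂) R,
    ∀ x' ∈ Metric.closedBall (0 : E₁ × E₂) R, (-f) x' ≤ (-f) x +
      (inner ℝ (grad₁ (-f) x) (x'.1 - x.1) + inner ℝ (grad₂ (-f) x) (x'.2 - x.2)) +
      L * (‖x'.1 - x.1‖ ^ 2 + ‖x'.2 - x.2‖ ^ 2) := by
  have hconv := convex_closedBall (0 : E₁ × E₂) R
  have hd : Differentiable ℝ (-f) := h.contDiff_neg.differentiable two_ne_zero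
  obtain ⟨L, hL⟩ := exists_lipschitzOnWith_of_contDiff
    (h.contDiff_neg.fderiv_right (m := 1) (by norm_num)) (isCompact_closedBall 0 R) hconv
  refine ⟨L, L.2, fun x hx x' hx' => ?_⟩
  have key := apply_le_add_of_lipschitzOnWith_fderiv hconv (fun y _ => (hd y).hasFDerivAt) hL hx hx'
  rw [fderiv_apply_eq_inner_grad (hd x)] at key
  have hnorm : ‖x' - x‖ ^ 2 ≤ ‖x'.1 - x.1‖ ^ 2 + ‖x'.2 - x.2‖ ^ 2 := by
    rw [Prod.norm_def, Prod.fst_sub, Prod.snd_sub]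
    rcases max_choice ‖x'.1 - x.1‖ ‖x'.2 - x.2‖ with e | e <;> rw [e]
    exacts [le_add_of_nonneg_right (sq_nonneg _), le_add_of_nonneg_left (sq_nonneg _)]
  have := mul_le_mul_of_nonneg_left hnorm L.2
  simp only [Prod.fst_sub, Prod.snd_sub] at key
  exact key.trans (by simpa using this)

theorem continuous_gapGrad₁ : Continuous (gapGrad₁ f r G) := by
  have := h.continuous_leader
  have := h.continuous_reaction
  have := (contDiff_grad₁ h.contDiff_neg).continuous
  unfold gapGrad₁
  fun_prop

theorem continuous_gap : Continuous fun x : E₁ × E₂ => f (x.1, r x.1) - f x := by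
  have := h.contDiff.continuous
  have := h.continuous_reaction
  fun_prop

variable {γ₁ γ₂ : ℕ → ℝ} {a m : ℕ → E₁} {b n : ℕ → E₂}
  (hγ₁ : IsLearningRate γ₁) (hγ₂ : IsLearningRate γ₂) (hγ : γ₁ =o[atTop] γ₂)
  (hrun : IsTameRun f r G γ₁ γ₂ a m b n)
include hγ₁ hrun

theorem summable_leader_step : Summable fun k => ‖γ₁ k • (G (a k, b k) + m k)‖ ^ 2 := by
  obtain ⟨R, hR⟩ := hrun.bounded
  obtain ⟨B, hB⟩ := (isCompact_closedBall (0 : E₁ × E₂) R).exists_bound_of_continuousOn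
    h.continuous_leader.continuousOn
  exact summable_norm_sq_step hγ₁.2.2 (fun k => hB _ (hR k)) hrun.summable₁

include hγ₂ hγ

theorem tendsto_gap_zero :
    Tendsto (fun k => f (a k, r (a k)) - f (a k, b k)) atTop (𝓝 0) := by
  obtain ⟨R, hR⟩ := hrun.bounded
  have hK := isCompact_closedBall (0 : E₁ × E₂) R
  have hcF : Continuous (grad₂ (-f)) := (contDiff_grad₂ h.contDiff_neg).continuous
  obtain ⟨L, hL0, hL⟩ := h.value_step
  obtain ⟨L', hL'0, hL'⟩ := h.neg_step R
  obtain ⟨BF, hBF⟩ := hK.exists_bound_of_continuousOn hcF.continuousOn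
  obtain ⟨BA, hBA⟩ := hK.exists_bound_of_continuousOn
    (h.continuous_gapGrad₁.inner h.continuous_leader : Continuous fun x =>
      (inner ℝ (gapGrad₁ f r G x) (G x) : ℝ)).continuousOn
  have hd1 := h.summable_leader_step hγ₁ hrun
  have hd2 : Summable fun k => ‖γ₂ k • (grad₂ (-f) (a k, b k) + n k)‖ ^ 2 :=
    summable_norm_sq_step hγ₂.2.2 (fun k => hBF _ (hR k)) hrun.summable₂
  have hsum := ((hd1.mul_left (L + L')).add (hd2.mul_left L')).tendsto_sum_tsum_nat
  refine tendsto_zero_of_stochastic_descent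
    (ψ := fun k => ‖grad₂ (-f) (a k, b k)‖ ^ 2)
    -- The leader's drift seen at the follower's scale: its first-order effect on the gap divided by
    -- `γ₂ k`. It vanishes by timescale separation and boundedness.
    (ε := fun k => -(γ₁ k / γ₂ k * inner ℝ (gapGrad₁ f r G (a k, b k)) (G (a k, b k))))
    (fun k => sub_nonneg.2 (h.apply_le_apply_reaction _ _)) hγ₂ ?_ (fun k => sq_nonneg _)
    (exists_tendsto_sum_add (exists_tendsto_sum_add (exists_tendsto_sum_neg hrun.tendsto_gap)
      (exists_tendsto_sum_neg hrun.tendsto_follower)) ⟨_, hsum⟩) (fun k => ?_) fun δ hδ => ?_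
  · rw [← neg_zero]
    refine Tendsto.neg (hγ.tendsto_div_nhds_zero.zero_mul_isBoundedUnder_le ?_)
    exact isBoundedUnder_of ⟨BA, fun k => hBA _ (hR k)⟩
  · have e1 : a (k + 1) - a k = -(γ₁ k • (G (a k, b k) + m k)) := by rw [hrun.step₁]; abel
    have e2 : b (k + 1) - b k = -(γ₂ k • (grad₂ (-f) (a k, b k) + n k)) := by
      rw [hrun.step₂]; abel
    have h1 := hL (a k) (a (k + 1))
    have h2 := hL' _ (hR k) _ (hR (k + 1))
    simp only [e1, e2, Pi.neg_apply, norm_neg] at h1 h2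
    have hγ0 := (hγ₂.1 k).ne'
    have e3 : γ₂ k * (‖grad₂ (-f) (a k, b k)‖ ^ 2 -
        -(γ₁ k / γ₂ k * inner ℝ (gapGrad₁ f r G (a k, b k)) (G (a k, b k)))) =
        γ₂ k * ‖grad₂ (-f) (a k, b k)‖ ^ 2 +
        γ₁ k * inner ℝ (gapGrad₁ f r G (a k, b k)) (G (a k, b k)) := by
      field_simp
      ring
    rw [e3]
    simp only [gapGrad₁, inner_neg_right, inner_smul_right, inner_add_right, inner_add_left,
      real_inner_self_eq_norm_sq] at h1 h2 ⊢
    linarith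
  · have hzero : ∀ x ∈ Metric.closedBall (0 : E₁ × E₂) R,
        ‖grad₂ (-f) x‖ ^ 2 ≤ 0 → f (x.1, r x.1) - f x ≤ 0 := by
      intro x _ hx
      have hx0 : grad₂ (-f) (x.1, x.2) = 0 := by simpa using le_antisymm hx (sq_nonneg _)
      simp [← h.eq_reaction_of_grad₂_neg_eq_zero hx0]
    obtain ⟨c, hc, hle⟩ := exists_pos_le_of_isCompact hK (by fun_prop) h.continuous_gap hzero hδ
    exact ⟨c, hc, fun k hk => hle _ (hR k) hk⟩

theorem tendsto_follower_sub_reaction : Tendsto (fun k => ‖b k - r (a k)‖) atTop (𝓝 0) := by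
  obtain ⟨R, hR⟩ := hrun.bounded
  have := h.continuous_reaction
  refine tendsto_zero_of_isCompact (isCompact_closedBall (0 : E₁ × E₂) R) h.continuous_gap
    (W := fun x : E₁ × E₂ => ‖x.2 - r x.1‖) (by fun_prop) (fun x _ hx => ?_)
    (fun x => norm_nonneg _) hR (h.tendsto_gap_zero hγ₁ hγ₂ hγ hrun)
  have hx' : f (x.1, x.2) = f (x.1, r x.1) :=
    le_antisymm (h.apply_le_apply_reaction _ _) (sub_nonpos.1 hx)
  simp [h.eq_reaction_of_apply_eq hx']

theorem tendsto_value : Tendsto (fun k => f (a k, r (a k)) - f (p, r p)) atTop (𝓝 0) := by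
  obtain ⟨R, hR⟩ := hrun.bounded
  have hK := isCompact_closedBall (0 : E₁ × E₂) R
  have hcr := h.continuous_reaction
  have hcG := h.continuous_leader
  have hcf := h.contDiff.continuous
  obtain ⟨L, hL0, hL⟩ := h.value_step
  obtain ⟨LG, hLG⟩ := h.lipschitz_leader
  obtain ⟨B, hB⟩ := hK.exists_bound_of_continuousOn
    (by fun_prop : Continuous fun x : E₁ × E₂ => G (x.1, r x.1)).continuousOn
  have hsum := ((h.summable_leader_step hγ₁ hrun).mul_left L).tendsto_sum_tsum_nat
  have herr : Tendsto (fun k => B * (LG * ‖b k - r (a k)‖)) atTop (𝓝 0) := by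
    simpa using ((h.tendsto_follower_sub_reaction hγ₁ hγ₂ hγ hrun).const_mul (LG : ℝ)).const_mul B
  refine tendsto_zero_of_stochastic_descent
    (ψ := fun k => ‖G (a k, r (a k))‖ ^ 2)
    -- The error from evaluating `G` off the graph of `r`; the Lipschitz bound on `G` controls it by
    -- `‖b k - r (a k)‖`, already known to vanish.
    (ε := fun k => -inner ℝ (G (a k, r (a k))) (G (a k, b k) - G (a k, r (a k))))
    (fun k => sub_nonneg.2 (h.value_le _)) hγ₁ ?_ (fun k => sq_nonneg _)
    (exists_tendsto_sum_add (exists_tendsto_sum_neg hrun.tendsto_leader) ⟨_, hsum⟩)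
    (fun k => ?_) fun δ hδ => ?_
  · refine squeeze_zero_norm (fun k => ?_) herr
    rw [norm_neg]
    refine (norm_inner_le_norm _ _).trans ?_
    have h1 := hLG.norm_sub_le (a k, b k) (a k, r (a k))
    rw [Prod.mk_sub_mk, sub_self, Prod.norm_mk, norm_zero, max_eq_right (norm_nonneg _)] at h1
    exact mul_le_mul (hB _ (hR k)) h1 (norm_nonneg _) ((norm_nonneg _).trans (hB _ (hR k)))
  · have e1 : a (k + 1) - a k = -(γ₁ k • (G (a k, b k) + m k)) := by rw [hrun.step₁]; abel
    have h1 := hL (a k) (a (k + 1))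
    simp only [e1, norm_neg, inner_neg_right, inner_smul_right, inner_add_right, inner_sub_right,
      real_inner_self_eq_norm_sq] at h1 ⊢
    linarith
  · have hzero : ∀ x ∈ Metric.closedBall (0 : E₁ × E₂) R,
        ‖G (x.1, r x.1)‖ ^ 2 ≤ 0 → f (x.1, r x.1) - f (p, r p) ≤ 0 := by
      intro x _ hx
      have hx0 : G (x.1, r x.1) = 0 := by simpa using le_antisymm hx (sq_nonneg _)
      simp [h.eq_of_leader_eq_zero hx0]
    obtain ⟨c, hc, hle⟩ := exists_pos_le_of_isCompact hK (by fun_prop) (by fun_prop) hzero hδ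
    exact ⟨c, hc, fun k hk => hle _ (hR k) hk⟩

theorem tendsto_equilibrium : Tendsto (fun k => (a k, b k)) atTop (𝓝 (p, r p)) := by
  obtain ⟨R, hR⟩ := hrun.bounded
  have hcr := h.continuous_reaction
  have hcf := h.contDiff.continuous
  have ha : Tendsto a atTop (𝓝 p) := by
    rw [tendsto_iff_norm_sub_tendsto_zero]
    refine tendsto_zero_of_isCompact (isCompact_closedBall (0 : E₁ × E₂) R)
      (V := fun x : E₁ × E₂ => f (x.1, r x.1) - f (p, r p))
      (W := fun x : E₁ × E₂ => ‖x.1 - p‖) (by fun_prop) (by fun_prop) (fun x _ hx => ?_)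
      (fun x => norm_nonneg _) hR (h.tendsto_value hγ₁ hγ₂ hγ hrun)
    simp [h.eq_of_value_eq (le_antisymm (sub_nonpos.1 hx) (h.value_le x.1))]
  have hb : Tendsto (fun k => (b k - r (a k)) + r (a k)) atTop (𝓝 (0 + r p)) :=
    (tendsto_zero_iff_norm_tendsto_zero.2
      (h.tendsto_follower_sub_reaction hγ₁ hγ₂ hγ hrun)).add ((hcr.tendsto p).comp ha)
  simp only [sub_add_cancel, zero_add] at hb
  exact ha.prodMk_nhds hb

end IsStableZeroSumGame

end Path

/-! ### Almost sure convergence of noise series. -/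

section Noise

variable {Ω : Type*} {mΩ : MeasurableSpace Ω} {μ : Measure Ω} [IsProbabilityMeasure μ]
  {ℱ : Filtration ℕ mΩ}

/-- Martingale increments are orthogonal in `L²`, so the cross terms integrate to zero. -/
theorem integral_sq_sum_le {ξ : ℕ → Ω → ℝ}
    (hmeas : ∀ k, StronglyMeasurable[ℱ (k + 1)] (ξ k)) (hL2 : ∀ k, MemLp (ξ k) 2 μ)
    (hcond : ∀ k, μ[ξ k | ℱ k] =ᵐ[μ] 0) {s : ℕ → ℝ} (hs : ∀ k, ∫ ω, ξ k ω ^ 2 ∂μ ≤ s k) (n : ℕ) :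
    ∫ ω, (∑ i ∈ Finset.range n, ξ i ω) ^ 2 ∂μ ≤ ∑ i ∈ Finset.range n, s i := by
  induction n with
  | zero => simp
  | succ n ih =>
    have hM : MemLp (fun ω => ∑ i ∈ Finset.range n, ξ i ω) 2 μ :=
      memLp_finsetSum _ fun i _ => hL2 i
    have hMm : StronglyMeasurable[ℱ n] fun ω => ∑ i ∈ Finset.range n, ξ i ω :=
      Finset.stronglyMeasurable_fun_sum _ fun i hi =>
        (hmeas i).mono (ℱ.mono (Finset.mem_range.1 hi))
    have hint : Integrable (fun ω => (∑ i ∈ Finset.range n, ξ i ω) * ξ n ω) μ :=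
      hM.integrable_mul (hL2 n)
    have hcross : ∫ ω, (∑ i ∈ Finset.range n, ξ i ω) * ξ n ω ∂μ = 0 := by
      rw [← integral_condExp (ℱ.le n)]
      refine integral_eq_zero_of_ae ?_
      refine (condExp_mul_of_stronglyMeasurable_left hMm hint
        ((hL2 n).integrable one_le_two)).trans ?_
      filter_upwards [hcond n] with ω hω
      simp [hω]
    have hexp : ∀ ω, (∑ i ∈ Finset.range (n + 1), ξ i ω) ^ 2 =
        (∑ i ∈ Finset.range n, ξ i ω) ^ 2 + 2 * ((∑ i ∈ Finset.range n, ξ i ω) * ξ n ω) +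
          ξ n ω ^ 2 := fun ω => by
      rw [Finset.sum_range_succ]
      ring
    have hint' : Integrable (fun ω => (∑ i ∈ Finset.range n, ξ i ω) ^ 2 +
        2 * ((∑ i ∈ Finset.range n, ξ i ω) * ξ n ω)) μ :=
      hM.integrable_sq.add (hint.const_mul 2)
    simp only [hexp]
    rw [integral_add hint' (hL2 n).integrable_sq,
      integral_add hM.integrable_sq (hint.const_mul 2), integral_const_mul, hcross,
      Finset.sum_range_succ]
    linarith [hs n]

theorem ae_exists_tendsto_sum_of_summable {ξ : ℕ → Ω → ℝ}
    (hmeas : ∀ k, StronglyMeasurable[ℱ (k + 1)] (ξ k)) (hL2 : ∀ k, MemLp (ξ k) 2 μ)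
    (hcond : ∀ k, μ[ξ k | ℱ k] =ᵐ[μ] 0) {s : ℕ → ℝ} (hs : ∀ k, ∫ ω, ξ k ω ^ 2 ∂μ ≤ s k)
    (hsum : Summable s) :
    ∀ᵐ ω ∂μ, ∃ l, Tendsto (fun n => ∑ i ∈ Finset.range n, ξ i ω) atTop (𝓝 l) := by
  have hM : ∀ n, MemLp (fun ω => ∑ i ∈ Finset.range n, ξ i ω) 2 μ := fun n =>
    memLp_finsetSum _ fun i _ => hL2 i
  have hmart : Martingale (fun n ω => ∑ i ∈ Finset.range n, ξ i ω) ℱ μ := by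
    refine martingale_of_condExp_sub_eq_zero_nat (fun n => ?_)
      (fun n => (hM n).integrable one_le_two) fun n => ?_
    · exact Finset.stronglyMeasurable_fun_sum _ fun i hi =>
        (hmeas i).mono (ℱ.mono (Finset.mem_range.1 hi))
    · have : ((fun ω => ∑ i ∈ Finset.range (n + 1), ξ i ω) -
          fun ω => ∑ i ∈ Finset.range n, ξ i ω) = ξ n := by
        ext ω
        simp [Finset.sum_range_succ]
      rw [this]
      exact hcond n
  have hs0 : ∀ k, 0 ≤ s k := fun k => (integral_nonneg fun ω => sq_nonneg _).trans (hs k)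
  have hbdd : ∀ n, eLpNorm (fun ω => ∑ i ∈ Finset.range n, ξ i ω) 1 μ ≤
      ((1 + ∑' i, s i).toNNReal : ENNReal) := by
    intro n
    rw [eLpNorm_one_eq_lintegral_enorm,
      ← ofReal_integral_norm_eq_lintegral_enorm ((hM n).integrable one_le_two)]
    refine ENNReal.ofReal_le_ofReal ?_
    calc ∫ ω, ‖∑ i ∈ Finset.range n, ξ i ω‖ ∂μ
        ≤ ∫ ω, (1 + (∑ i ∈ Finset.range n, ξ i ω) ^ 2) ∂μ := by
          refine integral_mono ((hM n).integrable one_le_two).norm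
            ((integrable_const 1).add (hM n).integrable_sq) fun ω => ?_
          rw [Real.norm_eq_abs]
          dsimp only
          nlinarith [sq_nonneg (|∑ i ∈ Finset.range n, ξ i ω| - 1),
            sq_abs (∑ i ∈ Finset.range n, ξ i ω), abs_nonneg (∑ i ∈ Finset.range n, ξ i ω)]
      _ = 1 + ∫ ω, (∑ i ∈ Finset.range n, ξ i ω) ^ 2 ∂μ := by
          rw [integral_add (integrable_const 1) (hM n).integrable_sq]
          simp
      _ ≤ 1 + ∑' i, s i := by
          gcongr
          exact (integral_sq_sum_le hmeas hL2 hcond hs n).trans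
            (hsum.sum_le_tsum _ fun i _ => hs0 i)
  filter_upwards [hmart.submartingale.ae_tendsto_limitProcess hbdd] with ω hω
  exact ⟨_, hω⟩

variable {E : Type*} [NormedAddCommGroup E] {w : ℕ → Ω → E} {A : ℕ → Set Ω} {γ : ℕ → ℝ} {C : ℝ}

/-- The coefficient `u k` is cut off outside `A k`. As `A k` is known at time `k`, the increments
keep conditional mean zero and gain summable second moments; on paths that stay in every `A k`
nothing changes. -/
theorem ae_exists_tendsto_sum_inner [InnerProductSpace ℝ E] [CompleteSpace E] {u : ℕ → Ω → E}
    {B : ℝ} (hA : ∀ k, MeasurableSet[ℱ k] (A k))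
    (hwm : ∀ k, StronglyMeasurable[ℱ (k + 1)] (w k)) (hw2 : ∀ k, MemLp (w k) 2 μ)
    (hw0 : ∀ k, μ[w k | ℱ k] =ᵐ[μ] 0) (hwC : ∀ k, ∫ ω in A k, ‖w k ω‖ ^ 2 ∂μ ≤ C)
    (hum : ∀ k, StronglyMeasurable[ℱ k] (u k)) (hu : ∀ k, ∀ ω ∈ A k, ‖u k ω‖ ≤ B)
    (hγ : Summable fun k => γ k ^ 2) :
    ∀ᵐ ω ∂μ, (∀ k, ω ∈ A k) →
      ∃ l, Tendsto (fun n => ∑ k ∈ Finset.range n, γ k * inner ℝ (u k ω) (w k ω)) atTop (𝓝 l) := by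
  let U : ℕ → Ω → E := fun k => (A k).indicator fun ω => γ k • u k ω
  let ξ : ℕ → Ω → ℝ := fun k ω => innerSL ℝ (U k ω) (w k ω)
  have hUm : ∀ k, StronglyMeasurable[ℱ k] (U k) := fun k =>
    ((hum k).const_smul (γ k)).indicator (hA k)
  have hξm : ∀ k, StronglyMeasurable[ℱ (k + 1)] (ξ k) := fun k =>
    ((hUm k).mono (ℱ.mono k.le_succ)).inner (hwm k)
  have hξ_ind : ∀ k ω, ‖ξ k ω‖ ≤ (A k).indicator (fun ω => |γ k| * |B| * ‖w k ω‖) ω := by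
    intro k ω
    by_cases hω : ω ∈ A k
    · simp only [ξ, U, Set.indicator_of_mem hω, innerSL_apply_apply]
      refine (norm_inner_le_norm _ _).trans ?_
      rw [norm_smul, Real.norm_eq_abs]
      gcongr
      exact (hu k ω hω).trans (le_abs_self B)
    · simp [ξ, U, Set.indicator_of_notMem hω]
  have hξ2 : ∀ k, MemLp (ξ k) 2 μ := fun k =>
    (hw2 k).of_le_mul (c := |γ k| * |B|) ((hξm k).mono (ℱ.le _)).aestronglyMeasurable
      (Eventually.of_forall fun ω => (hξ_ind k ω).trans
        (Set.indicator_le_self' (fun _ _ => by positivity) ω))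
  have hcond : ∀ k, μ[ξ k | ℱ k] =ᵐ[μ] 0 := fun k => by
    refine (condExp_bilin_of_stronglyMeasurable_left (innerSL ℝ) (hUm k)
      ((hξ2 k).integrable one_le_two) ((hw2 k).integrable one_le_two)).trans ?_
    filter_upwards [hw0 k] with ω hω
    simp [hω]
  have hs : ∀ k, ∫ ω, ξ k ω ^ 2 ∂μ ≤ γ k ^ 2 * (B ^ 2 * C) := by
    intro k
    have hint : Integrable (fun ω => γ k ^ 2 * B ^ 2 * ‖w k ω‖ ^ 2) μ :=
      (hw2 k).integrable_norm_pow two_ne_zero |>.const_mul _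
    calc ∫ ω, ξ k ω ^ 2 ∂μ
        ≤ ∫ ω, (A k).indicator (fun ω => γ k ^ 2 * B ^ 2 * ‖w k ω‖ ^ 2) ω ∂μ := by
          refine integral_mono (hξ2 k).integrable_sq (hint.indicator (ℱ.le k _ (hA k))) fun ω => ?_
          have h1 := hξ_ind k ω
          dsimp only
          by_cases hω : ω ∈ A k
          · rw [Set.indicator_of_mem hω] at h1 ⊢
            calc ξ k ω ^ 2 = ‖ξ k ω‖ ^ 2 := by rw [Real.norm_eq_abs, sq_abs]
              _ ≤ (|γ k| * |B| * ‖w k ω‖) ^ 2 := by gcongr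
              _ = _ := by rw [mul_pow, mul_pow, sq_abs, sq_abs]
          · rw [Set.indicator_of_notMem hω] at h1 ⊢
            have := norm_le_zero_iff.1 h1
            simp [this]
      _ = γ k ^ 2 * B ^ 2 * ∫ ω in A k, ‖w k ω‖ ^ 2 ∂μ := by
          rw [integral_indicator (ℱ.le k _ (hA k)), integral_const_mul]
      _ ≤ γ k ^ 2 * B ^ 2 * C := by gcongr; exact hwC k
      _ = _ := by ring
  filter_upwards [ae_exists_tendsto_sum_of_summable hξm hξ2 hcond hs (hγ.mul_right _)] with ω hω hωA
  simpa [ξ, U, Set.indicator_of_mem (hωA _), inner_smul_left] using hω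

theorem ae_summable_sq_mul_norm_sq (hA : ∀ k, MeasurableSet (A k)) (hw2 : ∀ k, MemLp (w k) 2 μ)
    (hwC : ∀ k, ∫ ω in A k, ‖w k ω‖ ^ 2 ∂μ ≤ C) (hγ : Summable fun k => γ k ^ 2) :
    ∀ᵐ ω ∂μ, (∀ k, ω ∈ A k) → Summable fun k => γ k ^ 2 * ‖w k ω‖ ^ 2 := by
  let F : ℕ → Ω → ℝ := fun k => (A k).indicator fun ω => γ k ^ 2 * ‖w k ω‖ ^ 2
  have hF0 : ∀ k ω, 0 ≤ F k ω := fun k => Set.indicator_nonneg fun _ _ => by positivity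
  have hFint : ∀ k, Integrable (F k) μ := fun k =>
    (((hw2 k).integrable_norm_pow two_ne_zero).const_mul _).indicator (hA k)
  have hFle : ∀ k, ∫ ω, F k ω ∂μ ≤ γ k ^ 2 * C := fun k => by
    simp only [F]
    rw [integral_indicator (hA k), integral_const_mul]
    gcongr
    exact hwC k
  have hFm : ∀ k, AEMeasurable (fun ω => ENNReal.ofReal (F k ω)) μ := fun k =>
    (hFint k).aestronglyMeasurable.aemeasurable.ennreal_ofReal
  -- By Tonelli, the expected value of the truncated series is at most `∑ γ k ^ 2 * C`, hence
  -- finite.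
  have hfin : ∫⁻ ω, ∑' k, ENNReal.ofReal (F k ω) ∂μ ≠ ⊤ := by
    rw [lintegral_tsum hFm]
    refine ne_top_of_le_ne_top (hγ.mul_right C).tsum_ofReal_ne_top (ENNReal.tsum_le_tsum fun k => ?_)
    rw [← ofReal_integral_eq_lintegral_ofReal (hFint k) (Eventually.of_forall (hF0 k))]
    exact ENNReal.ofReal_le_ofReal (hFle k)
  filter_upwards [ae_lt_top' (AEMeasurable.tsum hFm) hfin] with ω hω hωA
  have := ENNReal.summable_toReal hω.ne
  simpa [F, Set.indicator_of_mem (hωA _), mul_nonneg, sq_nonneg] using this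

theorem setIntegral_norm_sq_le_of_condExp_le {m : MeasurableSpace Ω} (hm : m ≤ mΩ) {v : Ω → E}
    {A : Set Ω} {b : Ω → ℝ} (hv : MemLp v 2 μ) (hA : MeasurableSet[m] A)
    (hb : μ[fun ω => ‖v ω‖ ^ 2 | m] ≤ᵐ[μ] b) (hC : 0 ≤ C) (hbC : ∀ ω ∈ A, b ω ≤ C) :
    ∫ ω in A, ‖v ω‖ ^ 2 ∂μ ≤ C := by
  rw [← setIntegral_condExp hm (hv.integrable_norm_pow two_ne_zero) hA]
  calc ∫ ω in A, (μ[fun ω => ‖v ω‖ ^ 2 | m]) ω ∂μ ≤ ∫ _ in A, C ∂μ := by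
        refine setIntegral_mono_on_ae integrable_condExp.integrableOn
          (integrable_const C).integrableOn (hm _ hA) ?_
        filter_upwards [hb] with ω hω hωA
        exact hω.trans (hbC ω hωA)
    _ = μ.real A * C := by simp
    _ ≤ C := mul_le_of_le_one_left hC measureReal_le_one

end Noise

/-! ### The natural filtration. -/

section History

variable {Ω : Type*} {mΩ : MeasurableSpace Ω} {μ : Measure Ω} [IsProbabilityMeasure μ]
  {E₁ E₂ : Type*} [MeasurableSpace E₁] [MeasurableSpace E₂]
  {x₁ w₁ : ℕ → Ω → E₁} {x₂ w₂ : ℕ → Ω → E₂}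

/-- The filtration generated by the history of the iterates and of the noise. -/
def historyFiltration (hx₁ : ∀ k, Measurable (x₁ k)) (hw₁ : ∀ k, Measurable (w₁ k))
    (hx₂ : ∀ k, Measurable (x₂ k)) (hw₂ : ∀ k, Measurable (w₂ k)) : Filtration ℕ mΩ where
  seq := history x₁ w₁ x₂ w₂
  mono' _ _ hij := biSup_mono fun _ hs => Set.mem_Iic.2 ((Set.mem_Iic.1 hs).trans hij)
  le' _ := iSup₂_le fun s _ =>
    (((hx₁ s).prodMk (hx₂ s)).prodMk ((hw₁ s).prodMk (hw₂ s))).comap_le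

theorem measurable_history (k : ℕ) : Measurable[history x₁ w₁ x₂ w₂ k]
    fun ω => ((x₁ k ω, x₂ k ω), (w₁ k ω, w₂ k ω)) :=
  (comap_measurable _).mono (le_iSup₂_of_le k Set.self_mem_Iic le_rfl) le_rfl

end History

/-! ### Martingale difference noise on bounded paths. -/

section NoiseOnPaths

variable {Ω : Type*} {mΩ : MeasurableSpace Ω} {μ : Measure Ω} [IsProbabilityMeasure μ]
  {ℱ : Filtration ℕ mΩ} {E E₁ E₂ : Type*}
  [NormedAddCommGroup E] [InnerProductSpace ℝ E] [FiniteDimensional ℝ E] [CompleteSpace E]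
  [MeasurableSpace E] [BorelSpace E]
  [NormedAddCommGroup E₁] [NormedSpace ℝ E₁] [FiniteDimensional ℝ E₁]
  [MeasurableSpace E₁] [BorelSpace E₁]
  [NormedAddCommGroup E₂] [NormedSpace ℝ E₂] [FiniteDimensional ℝ E₂]
  [MeasurableSpace E₂] [BorelSpace E₂]
  {x₁ : ℕ → Ω → E₁} {x₂ : ℕ → Ω → E₂} {w : ℕ → Ω → E} {γ : ℕ → ℝ}

theorem IsMartingaleDifferenceNoise.exists_setIntegral_le
    (hw : IsMartingaleDifferenceNoise μ ℱ x₁ x₂ w)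
    (hx : ∀ k, Measurable[ℱ k] fun ω => (x₁ k ω, x₂ k ω)) (R : ℝ) :
    ∃ C, ∀ k, ∫ ω in {ω | (x₁ k ω, x₂ k ω) ∈ Metric.closedBall 0 R}, ‖w (k + 1) ω‖ ^ 2 ∂μ ≤ C := by
  obtain ⟨hw2, -, c, hc⟩ := hw
  refine ⟨|c| * (1 + (R ^ 2 + R ^ 2)), fun k => setIntegral_norm_sq_le_of_condExp_le (ℱ.le k)
    (hw2 k) (hx k Metric.isClosed_closedBall.measurableSet) (hc k) (by positivity) fun ω hω => ?_⟩
  have hω' : ‖x₁ k ω‖ ≤ R ∧ ‖x₂ k ω‖ ≤ R := by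
    simpa [Prod.norm_def] using mem_closedBall_zero_iff.1 hω
  calc c * (1 + (‖x₁ k ω‖ ^ 2 + ‖x₂ k ω‖ ^ 2))
      ≤ |c| * (1 + (‖x₁ k ω‖ ^ 2 + ‖x₂ k ω‖ ^ 2)) := by
        gcongr
        exact le_abs_self c
    _ ≤ |c| * (1 + (R ^ 2 + R ^ 2)) := by
        gcongr
        exacts [hω'.1, hω'.2]

/-- Radii range over `ℕ` so that one null set serves every bounded path. -/
theorem IsMartingaleDifferenceNoise.ae_summable
    (hw : IsMartingaleDifferenceNoise μ ℱ x₁ x₂ w)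
    (hx : ∀ k, Measurable[ℱ k] fun ω => (x₁ k ω, x₂ k ω)) (hγ : IsLearningRate γ) :
    ∀ᵐ ω ∂μ, ∀ R : ℕ, (∀ k, (x₁ k ω, x₂ k ω) ∈ Metric.closedBall 0 (R : ℝ)) →
      Summable fun k => γ k ^ 2 * ‖w (k + 1) ω‖ ^ 2 := by
  refine ae_all_iff.2 fun R => ?_
  obtain ⟨C, hC⟩ := hw.exists_setIntegral_le hx R
  exact ae_summable_sq_mul_norm_sq
    (fun k => ℱ.le k _ (hx k Metric.isClosed_closedBall.measurableSet)) hw.1 hC hγ.2.2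

theorem IsMartingaleDifferenceNoise.ae_exists_tendsto
    (hw : IsMartingaleDifferenceNoise μ ℱ x₁ x₂ w)
    (hx : ∀ k, Measurable[ℱ k] fun ω => (x₁ k ω, x₂ k ω)) (hwm : ∀ k, Measurable[ℱ k] (w k))
    (hγ : IsLearningRate γ) {u : E₁ × E₂ → E} (hu : Continuous u) :
    ∀ᵐ ω ∂μ, ∀ R : ℕ, (∀ k, (x₁ k ω, x₂ k ω) ∈ Metric.closedBall 0 (R : ℝ)) →
      ∃ l, Tendsto (fun n => ∑ k ∈ Finset.range n,
        γ k * inner ℝ (u (x₁ k ω, x₂ k ω)) (w (k + 1) ω)) atTop (𝓝 l) := by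
  refine ae_all_iff.2 fun R => ?_
  obtain ⟨C, hC⟩ := hw.exists_setIntegral_le hx R
  obtain ⟨B, hB⟩ := (isCompact_closedBall (0 : E₁ × E₂) R).exists_bound_of_continuousOn
    hu.continuousOn
  -- The noise is shifted by one: `w (k + 1)` is the increment revealed at time `k + 1`, while its
  -- coefficient is known at time `k`.
  exact ae_exists_tendsto_sum_inner (u := fun k ω => u (x₁ k ω, x₂ k ω))
    (fun k => hx k Metric.isClosed_closedBall.measurableSet)
    (fun k => (hwm (k + 1)).stronglyMeasurable) hw.1 hw.2.1 hC
    (fun k => (hu.measurable.comp (hx k)).stronglyMeasurable) (fun k ω hω => hB _ hω) hγ.2.2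

end NoiseOnPaths

end StackelbergGame

/-! ### Equilibrium property and almost sure convergence. -/

theorem mainTheorem3 {d₁ d₂ : ℕ}
    (f : EuclideanSpace ℝ (Fin d₁) × EuclideanSpace ℝ (Fin d₂) → ℝ)
    (hf : ContDiff ℝ 2 f)
    -- the follower's reaction map: a Lipschitz family of globally asymptotically stable equilibria
    (r : EuclideanSpace ℝ (Fin d₁) → EuclideanSpace ℝ (Fin d₂))
    (hr_lip : ∃ L : ℝ≥0, LipschitzWith L r)
    (hr_gas : ∀ y, StackelbergGame.IsGloballyAsymptoticallyStable
      (fun z => -StackelbergGame.grad₂ (-f) (y, z)) (r y))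
    -- the leader's total derivative
    (G : EuclideanSpace ℝ (Fin d₁) × EuclideanSpace ℝ (Fin d₂) → EuclideanSpace ℝ (Fin d₁))
    (hG : StackelbergGame.IsLeaderField f (-f) r G)
    (hG_lip : ∃ L₁ : ℝ≥0, LipschitzWith L₁ G)
    (hG_bdd : ∃ M₁ : ℝ, ∀ x, ‖G x‖ ≤ M₁)
    (hF_lip : ∃ L₂ : ℝ≥0, LipschitzWith L₂ (StackelbergGame.grad₂ (-f)))
    -- the leader's reduced dynamics have a globally asymptotically stable equilibrium,
    -- which is non-degenerate
    (p : EuclideanSpace ℝ (Fin d₁))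
    (hp_gas : StackelbergGame.IsGloballyAsymptoticallyStable (fun y => -G (y, r y)) p)
    (hp_nondeg : (fderiv ℝ (fun y => G (y, r y)) p).IsInvertible)
    -- learning rates with timescale separation
    (γ₁ γ₂ : ℕ → ℝ)
    (hγ₁ : StackelbergGame.IsLearningRate γ₁) (hγ₂ : StackelbergGame.IsLearningRate γ₂)
    (hγ : γ₁ =o[atTop] γ₂)
    -- the iterates and the noise
    {Ω : Type*} [MeasurableSpace Ω] (μ : Measure Ω) [IsProbabilityMeasure μ]
    (x₁ w₁ : ℕ → Ω → EuclideanSpace ℝ (Fin d₁)) (x₂ w₂ : ℕ → Ω → EuclideanSpace ℝ (Fin d₂))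
    (hx₁_meas : ∀ k, Measurable (x₁ k)) (hx₂_meas : ∀ k, Measurable (x₂ k))
    (hw₁_meas : ∀ k, Measurable (w₁ k)) (hw₂_meas : ∀ k, Measurable (w₂ k))
    (hw₁ : StackelbergGame.IsMartingaleDifferenceNoise μ
      (StackelbergGame.history x₁ w₁ x₂ w₂) x₁ x₂ w₁)
    (hw₂ : StackelbergGame.IsMartingaleDifferenceNoise μ
      (StackelbergGame.history x₁ w₁ x₂ w₂) x₁ x₂ w₂)
    (hx₁ : ∀ k ω, x₁ (k + 1) ω = x₁ k ω - γ₁ k • (G (x₁ k ω, x₂ k ω) + w₁ (k + 1) ω))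
    (hx₂ : ∀ k ω, x₂ (k + 1) ω = x₂ k ω -
      γ₂ k • (StackelbergGame.grad₂ (-f) (x₁ k ω, x₂ k ω) + w₂ (k + 1) ω)) :
    StackelbergGame.IsDifferentialStackelberg f (-f) (p, r p) ∧
    ∀ᵐ ω ∂μ, BddAbove (Set.range fun k => ‖x₁ k ω‖ ^ 2 + ‖x₂ k ω‖ ^ 2) →
      Tendsto (fun k => (x₁ k ω, x₂ k ω)) atTop (𝓝 (p, r p)) := by
  have h : StackelbergGame.IsStableZeroSumGame f r G p :=
    ⟨hf, hr_lip, hr_gas, hG, hG_lip, hF_lip, hp_gas⟩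
  refine ⟨h.isDifferentialStackelberg hp_nondeg, ?_⟩
  let ℱ := StackelbergGame.historyFiltration hx₁_meas hw₁_meas hx₂_meas hw₂_meas
  have hhist : ∀ k, Measurable[ℱ k] fun ω => ((x₁ k ω, x₂ k ω), (w₁ k ω, w₂ k ω)) :=
    StackelbergGame.measurable_history
  have hx : ∀ k, Measurable[ℱ k] fun ω => (x₁ k ω, x₂ k ω) := fun k =>
    measurable_fst.comp (hhist k)
  have hw₁m : ∀ k, Measurable[ℱ k] (w₁ k) := fun k =>
    (measurable_fst.comp measurable_snd).comp (hhist k)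
  have hw₂m : ∀ k, Measurable[ℱ k] (w₂ k) := fun k =>
    (measurable_snd.comp measurable_snd).comp (hhist k)
  have hn₁ : StackelbergGame.IsMartingaleDifferenceNoise μ ℱ x₁ x₂ w₁ := hw₁
  have hn₂ : StackelbergGame.IsMartingaleDifferenceNoise μ ℱ x₁ x₂ w₂ := hw₂
  have hG_cont := h.continuous_leader
  have hr_cont := h.continuous_reaction
  filter_upwards [hn₁.ae_summable hx hγ₁, hn₂.ae_summable hx hγ₂,
    hn₁.ae_exists_tendsto hx hw₁m hγ₁ h.continuous_gapGrad₁,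
    hn₂.ae_exists_tendsto hx hw₂m hγ₂ (StackelbergGame.contDiff_grad₂ h.contDiff_neg).continuous,
    hn₁.ae_exists_tendsto hx hw₁m hγ₁ (u := fun x => G (x.1, r x.1)) (by fun_prop)]
    with ω hs₁ hs₂ ht₁ ht₂ ht₃ hbdd
  obtain ⟨B, hB⟩ := hbdd
  obtain ⟨R, hR⟩ := exists_nat_ge (Real.sqrt B)
  have hball : ∀ k, (x₁ k ω, x₂ k ω) ∈ Metric.closedBall 0 (R : ℝ) := by
    intro k
    have hk : ‖x₁ k ω‖ ^ 2 + ‖x₂ k ω‖ ^ 2 ≤ B := hB (Set.mem_range_self k)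
    rw [mem_closedBall_zero_iff, Prod.norm_mk]
    refine (max_le ?_ ?_).trans hR <;> refine Real.le_sqrt_of_sq_le ?_
    exacts [by linarith [sq_nonneg ‖x₂ k ω‖], by linarith [sq_nonneg ‖x₁ k ω‖]]
  exact h.tendsto_equilibrium (m := fun k => w₁ (k + 1) ω) (n := fun k => w₂ (k + 1) ω) hγ₁ hγ₂ hγ
    ⟨⟨R, hball⟩, fun k => hx₁ k ω, fun k => hx₂ k ω, hs₁ R hball, hs₂ R hball, ht₁ R hball,
      ht₂ R hball, ht₃ R hball⟩
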